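/- Conventions. Write $\mathcal Q(n)=(\mathbb C^2)^{\otimes n}$ and identify a bit string $x$ with $|x\rangle\langle x|$. Circuits are general quantum circuits over the gate set consisting of Hadamard, the phase gate, controlled-NOT, Toffoli, preparation of a fresh qubit $|0\rangle$, and tracing out a qubit. A family of circuits indexed by $\lambda\in\mathbb N^+$ is efficient if a deterministic polynomial-time Turing machine outputs a description of the $\lambda$-th circuit on input $1^\lambda$. A function $\eta:\mathbb N^+\to\mathbb R$ is negligible if $\lambda^c\eta(\lambda)\to0$ for every $c\in\mathbb N$. A quantum encryption of classical messages (QECM) scheme $\mathcal S$, with message, key and ciphertext sizes $n,\kappa,\ell:\mathbb N^+\to\mathbb N^+$, is a triple of efficient circuits $Key$ (no input, $\kappa$ output qubits), $Enc$ (from $\kappa+n$ to $\ell$ qubits), $Dec$ (from $\kappa+\ell$ to $n$ qubits) such that, for all $\lambda$, $k\in\{0,1\}^{\kappa(\lambda)}$ and $m\in\{0,1\}^{n(\lambda)}$, $\mathrm{Tr}[|k\rangle\langle k|Key(1)]>0$ implies $\mathrm{Tr}[|m\rangle\langle m|\,Dec_k\circ Enc_k(|m\rangle\langle m|)]=1$.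 Here and below, for a map $\Phi$ with a key register, $\Phi_k(\rho)=\Phi(|k\rangle\langle k|\otimes\rho)$; and $k\leftarrow\mathcal K$ means that $k$ is drawn with probability $\mathrm{Tr}[|k\rangle\langle k|Key(1)]$. A cloning attack on $\mathcal S$ is a triple of efficient circuits $A$ (from $\ell$ to $\beta+\gamma$ qubits), $B$ (from $\kappa+\beta$ to $n$ qubits), $C$ (from $\kappa+\gamma$ to $n$ qubits), for some $\beta,\gamma:\mathbb N^+\to\mathbb N^+$. Its winning probability at $\lambda$ is $$\mathbb E_{m}\,\mathbb E_{k\leftarrow\mathcal K}\mathrm{Tr}\big[(|m\rangle\langle m|\otimes|m\rangle\langle m|)\,(B_k\otimes C_k)\circ A\circ Enc_k(|m\rangle\langle m|)\big],$$ with $m$ uniform in $\{0,1\}^{n(\lambda)}$. The scheme is $t$-uncloneable secure if for every cloning attack there is a negligible $\eta$ such that the winning probability is at most $2^{-n(\lambda)+t(\lambda)}+\eta(\lambda)$ for all $\lambda$. A cloning-distinguishing attack on $\mathcal S$ is a tuple of efficient circuits $G$ (no input, $s+n$ output qubits), $A$ (from $s+\ell$ to $\beta+\gamma$ qubits), $B$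 (from $\kappa+\beta$ to $1$ qubit), $C$ (from $\kappa+\gamma$ to $1$ qubit), for some $s,\beta,\gamma:\mathbb N^+\to\mathbb N^+$. Let $Enc_k^0(\rho)=\mathrm{Tr}[\rho]\,Enc_k(|0^n\rangle\langle 0^n|)$ and $Enc_k^1(\rho)=\sum_{m}\mathrm{Tr}[|m\rangle\langle m|\rho]\,Enc_k(|m\rangle\langle m|)$. The winning probability at $\lambda$ is $$\mathbb E_{b}\,\mathbb E_{k\leftarrow\mathcal K}\mathrm{Tr}\big[(|b\rangle\langle b|\otimes|b\rangle\langle b|)\,(B_k\otimes C_k)\circ A\circ(\mathrm{Id}_S\otimes Enc_k^b)\circ G(1)\big],$$ with $b$ uniform in $\{0,1\}$. The scheme is uncloneable-indistinguishable secure if for every cloning-distinguishing attack there is a negligible $\eta$ such that the winning probability is at most $\tfrac12+\eta(\lambda)$ for all $\lambda$. Theorem. Let $\mathcal S$ be a QECM scheme with constant message size, $n(\lambda)=n$ for all $\lambda$. If $\mathcal S$ is $0$-uncloneable secure, then it is uncloneable-indistinguishable secure. Moreover (whether or not $\mathcal S$ is $0$-uncloneable secure), for every cloning-distinguishing attack $\mathcal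 A$ on $\mathcal S$ there is a cloning attack $\mathcal A'$ on $\mathcal S$ whose winning probability is, for every $\lambda\in\mathbb N^+$, at least $2^{-(n-1)}$ times that of $\mathcal A$. -/

import Mathlib

open scoped Kronecker BigOperators

namespace UncloneableEncryption

noncomputable section

/-! ### Qubit registers, operators and maps between them -/

/-- Bit strings of length `n`; they label the computational basis of the state space `𝒬(n)` of
`n` qubits. -/
abbrev Bits (n : ℕ) : Type := Fin n → Bool

/-- Linear operators on `𝒬(n)`, as matrices in the computational basis. -/
abbrev Op (n : ℕ) : Type := Matrix (Bits n) (Bits n) ℂ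

/-- Linear maps from operators on `𝒬(a)` to operators on `𝒬(b)`. -/
abbrev SuperOp (a b : ℕ) : Type := Op a →ₗ[ℂ] Op b

/-- The basis projector `|x⟩⟨x|`. -/
def ketbra {n : ℕ} (x : Bits n) : Op n := Matrix.single x x 1

/-- The tensor product of operators, under `𝒬(a) ⊗ 𝒬(b) = 𝒬(a + b)`,
`|x⟩ ⊗ |y⟩ = |x y⟩` (concatenation of bit strings). -/
def tensorOp {a b : ℕ} (ρ : Op a) (σ : Op b) : Op (a + b) :=
  Matrix.reindex (Fin.appendEquiv a b) (Fin.appendEquiv a b) (ρ ⊗ₖ σ)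

/-- The linear map `σ ↦ ρ ⊗ σ`. -/
def tensorLeft {a : ℕ} (ρ : Op a) (b : ℕ) : SuperOp b (a + b) where
  toFun σ := tensorOp ρ σ
  map_add' σ τ := by rw [tensorOp, Matrix.kronecker_add]; rfl
  map_smul' c σ := by rw [tensorOp, Matrix.kronecker_smul]; rfl

/-- The tensor product of maps: the linear extension of `ρ ⊗ σ ↦ Φ(ρ) ⊗ Ψ(σ)`, written out on the
matrix units `|p q⟩⟨p' q'| = |p⟩⟨p'| ⊗ |q⟩⟨q'|`. -/
def tensorMap {a b c d : ℕ} (Φ : SuperOp a c) (Ψ : SuperOp b d) : SuperOp (a + b) (c + d) where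
  toFun ρ := ∑ p : Bits a, ∑ p' : Bits a, ∑ q : Bits b, ∑ q' : Bits b,
    ρ (Fin.append p q) (Fin.append p' q') •
      tensorOp (Φ (Matrix.single p p' 1)) (Ψ (Matrix.single q q' 1))
  map_add' ρ σ := by simp only [Matrix.add_apply, add_smul, Finset.sum_add_distrib]
  map_smul' c ρ := by
    simp only [Matrix.smul_apply, smul_eq_mul, mul_smul, Finset.smul_sum, RingHom.id_apply]

/-- The conjugation `ρ ↦ U ρ U†`. -/
def conjBy {n : ℕ} (U : Op n) : SuperOp n n where
  toFun ρ := U * ρ * U.conjTranspose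
  map_add' ρ σ := by rw [Matrix.mul_add, Matrix.add_mul]
  map_smul' c ρ := by simp

/-! ### General quantum circuits -/

/-- Gates acting on a list of `a` qubits and leaving a list of `b` qubits. The unitary gates are
the universal set consisting of Hadamard, the phase gate, controlled-NOT and Toffoli; the other
two gates are the preparation of a fresh qubit in state `|0⟩`, which becomes the `i`-th qubit of
the new list, and the partial trace over the `i`-th qubit. -/
inductive Gate : ℕ → ℕ → Type
  | hadamard {n : ℕ} (i : Fin n) : Gate n n
  | phase {n : ℕ} (i : Fin n) : Gate n n
  | cnot {n : ℕ} (control target : Fin n) (h : control ≠ target) : Gate n n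
  | toffoli {n : ℕ} (control₁ control₂ target : Fin n) (h₁₂ : control₁ ≠ control₂)
      (h₁ : control₁ ≠ target) (h₂ : control₂ ≠ target) : Gate n n
  | aux {n : ℕ} (i : Fin (n + 1)) : Gate n (n + 1)
  | discard {n : ℕ} (i : Fin (n + 1)) : Gate (n + 1) n

/-- A quantum circuit with `a` input and `b` output qubits: a sequence of gates. -/
inductive Circuit : ℕ → ℕ → Type
  | nil (n : ℕ) : Circuit n n
  | cons {a b c : ℕ} (g : Gate a b) (C : Circuit b c) : Circuit a c

/-- The unitary `|x⟩ ↦ (|x with xᵢ = 0⟩ + (-1)^{xᵢ} |x with xᵢ = 1⟩) / √2`. -/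
def hadamardMatrix {n : ℕ} (i : Fin n) : Op n := Matrix.of fun y x =>
  if ∀ j, j ≠ i → y j = x j then
    (if x i = true ∧ y i = true then -1 else 1) / (Real.sqrt 2 : ℂ)
  else 0

/-- The unitary `|x⟩ ↦ i^{xᵢ} |x⟩`. -/
def phaseMatrix {n : ℕ} (i : Fin n) : Op n :=
  Matrix.diagonal fun x => if x i = true then Complex.I else 1

/-- The operator `|x⟩ ↦ |f(x)⟩`. -/
def basisMap {n : ℕ} (f : Bits n → Bits n) : Op n := Matrix.of fun y x => if y = f x then 1 else 0

/-- The map on operators implemented by a gate. -/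
def Gate.toMap : {a b : ℕ} → Gate a b → SuperOp a b
  | _, _, .hadamard i => conjBy (hadamardMatrix i)
  | _, _, .phase i => conjBy (phaseMatrix i)
  | _, _, .cnot c t _ => conjBy (basisMap fun x => Function.update x t (xor (x t) (x c)))
  | _, _, .toffoli c₁ c₂ t _ _ _ =>
      conjBy (basisMap fun x => Function.update x t (xor (x t) (x c₁ && x c₂)))
  | _, _, .aux i =>
      { toFun := fun ρ => Matrix.of fun x y =>
          if x i = false ∧ y i = false then ρ (i.removeNth x) (i.removeNth y) else 0
        map_add' := fun ρ σ => by
          ext x y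
          simp only [Matrix.of_apply, Matrix.add_apply]
          split_ifs <;> simp
        map_smul' := fun c ρ => by
          ext x y
          simp [Matrix.of_apply, Matrix.smul_apply] }
  | _, _, .discard i =>
      { toFun := fun ρ => Matrix.of fun x y =>
          ∑ b : Bool, ρ (i.insertNth b x) (i.insertNth b y)
        map_add' := fun ρ σ => by
          ext x y
          simp only [Matrix.of_apply, Matrix.add_apply, Finset.sum_add_distrib]
        map_smul' := fun c ρ => by
          ext x y
          simp only [Matrix.of_apply, Matrix.smul_apply, Finset.smul_sum, RingHom.id_apply] }

/-- The CPTP map implemented by a circuit. -/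
def Circuit.toMap : {a b : ℕ} → Circuit a b → SuperOp a b
  | _, _, .nil _ => LinearMap.id
  | _, _, .cons g C => C.toMap ∘ₗ g.toMap

/-! ### Descriptions of circuits and polynomial-time uniformity -/

/-- The finite alphabet in which circuits are described. -/
inductive Symbol
  | hadamard | phase | cnot | toffoli | aux | discard | tick | stop_mark

/-- A natural number in unary, with an end marker. -/
def describeNat (n : ℕ) : List Symbol := List.replicate n Symbol.tick ++ [Symbol.stop_mark]

/-- The description of a gate: its type and the positions of the qubits it acts on. -/
def Gate.describe : {a b : ℕ} → Gate a b → List Symbol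
  | _, _, .hadamard i => Symbol.hadamard :: describeNat i
  | _, _, .phase i => Symbol.phase :: describeNat i
  | _, _, .cnot c t _ => Symbol.cnot :: (describeNat c ++ describeNat t)
  | _, _, .toffoli c₁ c₂ t _ _ _ =>
      Symbol.toffoli :: (describeNat c₁ ++ describeNat c₂ ++ describeNat t)
  | _, _, .aux i => Symbol.aux :: describeNat i
  | _, _, .discard i => Symbol.discard :: describeNat i

/-- The descriptions of the gates of a circuit, in order. -/
def Circuit.describeGates : {a b : ℕ} → Circuit a b → List Symbol
  | _, _, .nil _ => []
  | _, _, .cons g C => g.describe ++ C.describeGates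

/-- The description of a circuit: the number of input qubits, the number of output qubits, and the
list of gates. -/
def Circuit.describe {a b : ℕ} (C : Circuit a b) : List Symbol :=
  describeNat a ++ describeNat b ++ C.describeGates

/-- A family of circuits indexed by the positive integers is polynomial-time uniform if a
deterministic polynomial-time Turing machine writes down the description of the `lam`-th circuit
on input `1 ^ lam`. -/
def PolyTimeUniform {a b : ℕ+ → ℕ} (C : ∀ lam : ℕ+, Circuit (a lam) (b lam)) : Prop :=
  Nonempty (Turing.TM2ComputableInPolyTime
    (fun lam : ℕ+ => Computability.unaryEncodeNat (lam : ℕ)) (id : List Symbol → List Symbol)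
    (fun lam : ℕ+ => (C lam).describe))

/-- Efficient circuits, with `a lam` input and `b lam` output qubits. -/
structure EfficientCircuits (a b : ℕ+ → ℕ) where
  circuit : ∀ lam : ℕ+, Circuit (a lam) (b lam)
  uniform : PolyTimeUniform circuit

/-- The CPTP map implemented by the `lam`-th circuit of the family. -/
def EfficientCircuits.map {a b : ℕ+ → ℕ} (F : EfficientCircuits a b) (lam : ℕ+) :
    SuperOp (a lam) (b lam) :=
  (F.circuit lam).toMap

/-! ### Quantum encryptions of classical messages -/

/-- For a map `Φ` with a key register, the map `Φ_k : ρ ↦ Φ(|k⟩⟨k| ⊗ ρ)`. -/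
def withKey {κ a b : ℕ} (Φ : SuperOp (κ + a) b) (k : Bits κ) : SuperOp a b :=
  Φ ∘ₗ tensorLeft (ketbra k) a

/-- `Tr[P ρ]`, the probability of the outcome given by a projector `P` in the state `ρ`. -/
def outcomeProb {n : ℕ} (P ρ : Op n) : ℝ := (Matrix.trace (P * ρ)).re

/-- A quantum encryption of classical messages, with message size `n`, key size `κ` and
ciphertext size `ℓ`. The operator `1 : Op 0` is the unique state of zero qubits. -/
structure QECM where
  n : ℕ+ → ℕ+
  κ : ℕ+ → ℕ+
  ℓ : ℕ+ → ℕ+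
  Key : EfficientCircuits (fun _ => 0) (fun lam => κ lam)
  Enc : EfficientCircuits (fun lam => κ lam + n lam) (fun lam => ℓ lam)
  Dec : EfficientCircuits (fun lam => κ lam + ℓ lam) (fun lam => n lam)
  correct : ∀ (lam : ℕ+) (k : Bits (κ lam)) (m : Bits (n lam)),
    0 < outcomeProb (ketbra k) (Key.map lam 1) →
      outcomeProb (ketbra m)
        ((withKey (Dec.map lam) k ∘ₗ withKey (Enc.map lam) k) (ketbra m)) = 1

namespace QECM

variable (S : QECM)

/-- The probability that the key `k` is generated. -/
def keyProb (lam : ℕ+) (k : Bits (S.κ lam)) : ℝ := outcomeProb (ketbra k) (S.Key.map lam 1)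

/-- The encryption map `Enc_k`. -/
def encWith (lam : ℕ+) (k : Bits (S.κ lam)) : SuperOp (S.n lam) (S.ℓ lam) :=
  withKey (S.Enc.map lam) k

/-- The maps `Enc_k^0` (discard the plaintext, encrypt `0ⁿ`) and `Enc_k^1` (measure the plaintext in
the computational basis, encrypt the result). -/
def encBit (lam : ℕ+) (k : Bits (S.κ lam)) : Bool → SuperOp (S.n lam) (S.ℓ lam)
  | false => (Matrix.traceLinearMap (Bits (S.n lam)) ℂ ℂ).smulRight
      (S.encWith lam k (ketbra fun _ => false))
  | true => ∑ m : Bits (S.n lam),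
      (Matrix.traceLinearMap (Bits (S.n lam)) ℂ ℂ ∘ₗ LinearMap.mulLeft ℂ (ketbra m)).smulRight
        (S.encWith lam k (ketbra m))

end QECM

/-! ### Cloning attacks and uncloneable security -/

/-- A cloning attack `(A, B, C)` against `S`. -/
structure CloningAttack (S : QECM) where
  β : ℕ+ → ℕ+
  γ : ℕ+ → ℕ+
  A : EfficientCircuits (fun lam => S.ℓ lam) (fun lam => β lam + γ lam)
  B : EfficientCircuits (fun lam => S.κ lam + β lam) (fun lam => S.n lam)
  C : EfficientCircuits (fun lam => S.κ lam + γ lam) (fun lam => S.n lam)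

/-- The winning probability of a cloning attack, for a uniformly random message. -/
def CloningAttack.winProb {S : QECM} (𝒜 : CloningAttack S) (lam : ℕ+) : ℝ :=
  𝔼 m : Bits (S.n lam), ∑ k : Bits (S.κ lam), S.keyProb lam k *
    outcomeProb (tensorOp (ketbra m) (ketbra m))
      ((tensorMap (withKey (𝒜.B.map lam) k) (withKey (𝒜.C.map lam) k) ∘ₗ 𝒜.A.map lam ∘ₗ
        S.encWith lam k) (ketbra m))

/-- A function of the security parameter is negligible if it decays faster than every inverse
polynomial. -/
def Negligible (η : ℕ+ → ℝ) : Prop :=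
  Asymptotics.SuperpolynomialDecay Filter.atTop (fun lam : ℕ+ => (lam : ℝ)) η

/-- `t`-uncloneable security. -/
def QECM.UncloneableSecure (S : QECM) (t : ℕ+ → ℝ) : Prop :=
  ∀ 𝒜 : CloningAttack S, ∃ η : ℕ+ → ℝ, Negligible η ∧
    ∀ lam : ℕ+, 𝒜.winProb lam ≤ (2 : ℝ) ^ (-((S.n lam : ℕ) : ℝ) + t lam) + η lam

/-! ### Cloning-distinguishing attacks and uncloneable-indistinguishable security -/

/-- A cloning-distinguishing attack `(G, A, B, C)` against `S`. -/
structure CloningDistinguishingAttack (S : QECM) where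
  s : ℕ+ → ℕ+
  β : ℕ+ → ℕ+
  γ : ℕ+ → ℕ+
  G : EfficientCircuits (fun _ => 0) (fun lam => s lam + S.n lam)
  A : EfficientCircuits (fun lam => s lam + S.ℓ lam) (fun lam => β lam + γ lam)
  B : EfficientCircuits (fun lam => S.κ lam + β lam) (fun _ => 1)
  C : EfficientCircuits (fun lam => S.κ lam + γ lam) (fun _ => 1)

/-- The projector `|b⟩⟨b|` on a single qubit. -/
def qubitProj (b : Bool) : Op 1 := ketbra fun _ => b

/-- The winning probability of a cloning-distinguishing attack. -/
def CloningDistinguishingAttack.winProb {S : QECM} (𝒜 : CloningDistinguishingAttack S)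
    (lam : ℕ+) : ℝ :=
  𝔼 b : Bool, ∑ k : Bits (S.κ lam), S.keyProb lam k *
    outcomeProb (tensorOp (qubitProj b) (qubitProj b))
      ((tensorMap (withKey (𝒜.B.map lam) k) (withKey (𝒜.C.map lam) k) ∘ₗ 𝒜.A.map lam ∘ₗ
        tensorMap (LinearMap.id : SuperOp (𝒜.s lam) (𝒜.s lam)) (S.encBit lam k b) ∘ₗ
        𝒜.G.map lam) 1)

/-- Uncloneable-indistinguishable security. -/
def QECM.UncloneableIndistinguishableSecure (S : QECM) : Prop :=
  ∀ 𝒜 : CloningDistinguishingAttack S, ∃ η : ℕ+ → ℝ, Negligible η ∧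
    ∀ lam : ℕ+, 𝒜.winProb lam ≤ 1 / 2 + η lam

end

end UncloneableEncryption

namespace UncloneableEncryption

open scoped Kronecker Matrix ComplexOrder BigOperators

noncomputable section

open Turing Turing.TM2 Computability StateTransition


/-! From a cloning-distinguishing attack (G, A, B, C) one builds a cloning attack on a uniform
message m. The splitter runs G itself, measures its message register to get a string q, applies A to
the side register and the ciphertext, and gives each party a classical copy of q. Once the key is
known the parties run B and C, obtain bits b and c, and answer b ∧ q and c ∧ q bitwise, so each
answer is 0^n or q. If m = 0^n, the ciphertext is the one of the distinguishing game for bit 0, and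
b = c = 0 makes both answers right. If m = q, it is the one for bit 1, and b = c = 1 does. Each of
these values of m has probability 2^(-n), against 1/2 for each bit in the distinguishing game,
whence the factor 2 * 2^(-n). For q = 0^n the two messages coincide but the outcome pairs still
differ, so nothing is counted twice (`jointProb_add_le`, with positivity from `IsKraus`). Measuring
q costs nothing, because both encryption maps of the game are unchanged by a prior measurement of
the message (`tensorMap_id_encBit`). For constant n, a bound 2^(-n) + η on cloning becomes 1/2 +
2^(n-1) η on distinguishing, and the error stays negligible.

The larger part of the proof shows that the new attack is efficient in the Turing machine sense.
`PolyTime.transduce` runs two polynomial-time machines and passes their outputs through a finite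
transducer; concatenation, constants, deletion of a prefix and parsing of circuit headers all follow
from it. The circuits are chosen so that these operations suffice. Given circuits act on the first
qubits of a longer list, which leaves the words of their gates unchanged, and registers are moved or
copied by repeating a fixed word n times. The action of these circuits is computed on matrix units
and product operators (`toMap_splitter`, `toMap_firstGuesser`, `toMap_secondGuesser`) and assembled
in `outcomeProb_splitter`. -/

/-! ### Runs of a deterministic transition function -/

/-- Exactly `t` steps of `f` lead from `a` to `b`. -/
def RunsIn {X : Type*} (f : X → Option X) (t : ℕ) (a b : X) : Prop :=
  (flip bind f)^[t] (some a) = some b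

theorem RunsIn.refl {X : Type*} (f : X → Option X) (a : X) : RunsIn f 0 a a := rfl

theorem RunsIn.trans {X : Type*} {f : X → Option X} {s t : ℕ} {a b c : X}
    (h₁ : RunsIn f s a b) (h₂ : RunsIn f t b c) : RunsIn f (s + t) a c := by
  unfold RunsIn at *
  rw [add_comm, Function.iterate_add_apply, h₁, h₂]

theorem RunsIn.single {X : Type*} {f : X → Option X} {a b : X} (h : f a = some b) :
    RunsIn f 1 a b := by
  simpa [RunsIn, flip] using h

theorem RunsIn.head {X : Type*} {f : X → Option X} {t : ℕ} {a b c : X} (h : f a = some b)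
    (h₂ : RunsIn f t b c) : RunsIn f (t + 1) a c := by
  rw [add_comm]
  exact (RunsIn.single h).trans h₂

theorem iterate_bind_none {X : Type*} (f : X → Option X) (t : ℕ) :
    (flip bind f)^[t] (none : Option X) = none := by
  induction t with
  | zero => rfl
  | succ t ih => rw [Function.iterate_succ_apply]; exact ih

theorem RunsIn.exists_head {X : Type*} {f : X → Option X} {t : ℕ} {a c : X}
    (h : RunsIn f (t + 1) a c) : ∃ b, f a = some b ∧ RunsIn f t b c := by
  unfold RunsIn at h
  rw [Function.iterate_succ_apply] at h
  cases hb : f a with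
  | none =>
    have : flip bind f (some a) = none := by simpa [flip] using hb
    rw [this, iterate_bind_none] at h
    exact absurd h (by simp)
  | some b =>
    refine ⟨b, rfl, ?_⟩
    have : flip bind f (some a) = some b := by simpa [flip] using hb
    rw [this] at h
    exact h

/-! ### Stacks grow by a bounded amount in every step -/

section Growth

variable {K : Type*} {Γ : K → Type*} {Λ σ : Type*}

/-- A bound for the number of symbols pushed by a statement. -/
def pushBound : Stmt Γ Λ σ → ℕ
  | .push _ _ q => pushBound q + 1
  | .peek _ _ q => pushBound q
  | .pop _ _ q => pushBound q
  | .load _ q => pushBound q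
  | .branch _ q₁ q₂ => pushBound q₁ + pushBound q₂
  | .goto _ => 0
  | .halt => 0

theorem length_stk_stepAux_le [DecidableEq K] (q : Stmt Γ Λ σ) (v : σ) (S : ∀ k, List (Γ k))
    (k : K) : ((stepAux q v S).stk k).length ≤ (S k).length + pushBound q := by
  induction q generalizing v S with
  | push k' f q ih =>
    refine (ih _ _).trans ?_
    by_cases h : k = k'
    · subst h; simp [pushBound]; omega
    · simp [pushBound, h]
  | peek k' f q ih => exact ih _ _
  | pop k' f q ih =>
    refine (ih _ _).trans ?_
    by_cases h : k = k'
    · subst h; simp [pushBound]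
    · simp [pushBound, h]
  | load f q ih => exact ih _ _
  | branch f q₁ q₂ ih₁ ih₂ =>
    simp only [stepAux, pushBound]
    cases f v
    · exact (ih₂ _ _).trans (by omega)
    · exact (ih₁ _ _).trans (by omega)
  | goto f => simp [pushBound]
  | halt => simp [pushBound]

/-- There are finitely many labels, so the sum of their push bounds controls the growth in any
single step. This turns a time bound into a bound on output length, hence on the time needed to
reread that output. -/
theorem exists_length_stk_le [DecidableEq K] [Fintype Λ] (M : Λ → Stmt Γ Λ σ) :
    ∃ C : ℕ, ∀ (t : ℕ) (c c' : Cfg Γ Λ σ), RunsIn (TM2.step M) t c c' →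
      ∀ k, (c'.stk k).length ≤ (c.stk k).length + C * t := by
  refine ⟨∑ l, pushBound (M l), fun t => ?_⟩
  induction t with
  | zero => intro c c' h k; cases h; simp
  | succ t ih =>
    intro c c' h k
    obtain ⟨b, hb, h⟩ := h.exists_head
    have h₁ := ih b c' h k
    obtain ⟨l, v, S⟩ := c
    cases l with
    | none => simp [TM2.step] at hb
    | some l =>
      simp only [TM2.step, Option.some.injEq] at hb
      subst hb
      have h₂ := length_stk_stepAux_le (M l) v S k
      have h₃ : pushBound (M l) ≤ ∑ l, pushBound (M l) :=
        Finset.single_le_sum (f := fun l => pushBound (M l)) (fun _ _ => Nat.zero_le _)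
          (Finset.mem_univ l)
      rw [Nat.mul_succ]
      simp only at h₂ ⊢
      omega

end Growth

/-! ### The alphabet -/

/-- A numbering of the alphabet. -/
def Symbol.toFin : Symbol → Fin 8
  | .hadamard => 0 | .phase => 1 | .cnot => 2 | .toffoli => 3
  | .aux => 4 | .discard => 5 | .tick => 6 | .stop_mark => 7

theorem Symbol.toFin_injective : Function.Injective Symbol.toFin := by
  intro a b h
  cases a <;> cases b <;> first | rfl | (exact absurd h (by decide))

instance : Fintype Symbol := Fintype.ofInjective _ Symbol.toFin_injective

/-! ### Polynomial-time functions of the security parameter, and the length of their values. -/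

/-- Functions of the security parameter computable in polynomial time. -/
def PolyTime (f : ℕ+ → List Symbol) : Prop :=
  Nonempty (TM2ComputableInPolyTime (fun lam : ℕ+ => unaryEncodeNat (lam : ℕ))
    (id : List Symbol → List Symbol) f)

theorem unaryEncodeNat_eq_replicate (n : ℕ) : unaryEncodeNat n = List.replicate n true := by
  induction n with
  | zero => rfl
  | succ n ih => rw [unaryEncodeNat, ih, List.replicate_succ]

/-- The stacks of a machine of which all but one are empty. -/
def oneStack (tm : FinTM2) (k : tm.K) (s : List (tm.Γ k)) : ∀ k, List (tm.Γ k) :=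
  Function.update (fun _ => []) k s

theorem length_oneStack_le (tm : FinTM2) (k k' : tm.K) (s : List (tm.Γ k)) :
    (oneStack tm k s k').length ≤ s.length := by
  by_cases h : k' = k
  · subst h; simp [oneStack]
  · simp [oneStack, h]

theorem initList_eq (tm : FinTM2) (s : List (tm.Γ tm.k₀)) :
    initList tm s = ⟨some tm.main, tm.initialState, oneStack tm tm.k₀ s⟩ := by
  unfold initList oneStack
  congr 1
  funext k
  by_cases h : k = tm.k₀
  · subst h; simp
  · simp [h]

theorem haltList_eq (tm : FinTM2) (s : List (tm.Γ tm.k₁)) :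
    haltList tm s = ⟨none, tm.initialState, oneStack tm tm.k₁ s⟩ := by
  unfold haltList oneStack
  congr 1
  funext k
  by_cases h : k = tm.k₁
  · subst h; simp
  · simp [h]

theorem length_le_of_runsIn (tm : FinTM2) : ∃ C : ℕ, ∀ t s s',
    RunsIn tm.step t (initList tm s) (haltList tm s') → s'.length ≤ s.length + C * t := by
  have := tm.ΛFin
  obtain ⟨C, hC⟩ := exists_length_stk_le tm.m
  refine ⟨C, fun t s s' h => ?_⟩
  have := hC t _ _ h tm.k₁
  rw [initList_eq, haltList_eq] at this
  simp only [oneStack, Function.update_self] at this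
  exact this.trans (Nat.add_le_add_right (length_oneStack_le tm _ _ _) _)


/-! ### Finite transducers -/

/-- A finite transducer reading two words, one after the other. -/
structure Transducer (Q : Type) where
  start : Q
  next : Q → Bool → Symbol → Q
  out : Q → Bool → Symbol → List Symbol

namespace Transducer

variable {Q : Type} (T : Transducer Q)

/-- The state after reading the word `w` in position `i`. -/
def stateAfter (i : Bool) (q : Q) (w : List Symbol) : Q := w.foldl (fun q a => T.next q i a) q

/-- The output on the word `w` in position `i`, from the state `q`. -/
def output (i : Bool) : Q → List Symbol → List Symbol
  | _, [] => []
  | q, a :: w => T.out q i a ++ output i (T.next q i a) w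

/-- The output on a pair of words. -/
def eval (u v : List Symbol) : List Symbol :=
  T.output false T.start u ++ T.output true (T.stateAfter false T.start u) v

theorem exists_length_output_le [Fintype Q] : ∃ L : ℕ, ∀ i q w,
    (T.output i q w).length ≤ L * w.length := by
  refine ⟨∑ q : Q, ∑ i : Bool, ∑ a : Symbol, (T.out q i a).length, fun i q w => ?_⟩
  have key : ∀ q i a, (T.out q i a).length ≤
      ∑ q : Q, ∑ i : Bool, ∑ a : Symbol, (T.out q i a).length := fun q i a =>
    calc (T.out q i a).length ≤ ∑ a : Symbol, (T.out q i a).length :=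
          Finset.single_le_sum (f := fun a => (T.out q i a).length) (fun _ _ => Nat.zero_le _)
            (Finset.mem_univ a)
      _ ≤ ∑ i : Bool, ∑ a : Symbol, (T.out q i a).length :=
          Finset.single_le_sum (f := fun i => ∑ a : Symbol, (T.out q i a).length)
            (fun _ _ => Nat.zero_le _) (Finset.mem_univ i)
      _ ≤ _ := Finset.single_le_sum
            (f := fun q => ∑ i : Bool, ∑ a : Symbol, (T.out q i a).length)
            (fun _ _ => Nat.zero_le _) (Finset.mem_univ q)
  induction w generalizing q with
  | nil => simp [output]
  | cons a w ih =>
    rw [output, List.length_append, List.length_cons, Nat.mul_succ, add_comm]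
    exact Nat.add_le_add (ih _) (key q i a)

end Transducer

/-! ### The machine that runs two machines and feeds their outputs to a transducer -/

/-- The stacks of the combined machine that belong to neither of the two machines. -/
inductive AuxStack
  | input | work | output
  deriving DecidableEq

instance : Fintype AuxStack := ⟨{.input, .work, .output}, fun x => by cases x <;> simp⟩

/-- The labels of the combined machine that belong to neither of the two machines. -/
inductive Control (Q : Type)
  | copy
  | read (i : Bool) (q : Q)
  | emit (i : Bool) (q : Q) (a : Symbol)
  | write

/-- `Control Q` as a sum type. -/
def Control.toSum {Q : Type} : Control Q → Bool ⊕ (Bool × Q) ⊕ (Bool × Q × Symbol)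
  | copy => .inl false
  | read i q => .inr (.inl (i, q))
  | emit i q a => .inr (.inr (i, q, a))
  | write => .inl true

theorem Control.toSum_injective {Q : Type} : Function.Injective (Control.toSum (Q := Q)) := by
  intro a b h
  cases a <;> cases b <;> simp_all [Control.toSum]

instance {Q : Type} [Fintype Q] : Fintype (Control Q) :=
  Fintype.ofInjective _ Control.toSum_injective

section Combine

variable (tm : Bool → FinTM2)

/-- The stack indices of the combined machine. -/
abbrev CStack : Type := (Σ i, (tm i).K) ⊕ AuxStack

/-- The stack alphabets of the combined machine. -/
@[reducible] def CΓ : CStack tm → Type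
  | .inl ⟨i, k⟩ => (tm i).Γ k
  | .inr .input => Bool
  | .inr .work => Symbol
  | .inr .output => Symbol

/-- The labels of the combined machine. -/
abbrev CΛ (Q : Type) : Type := (Σ i, (tm i).Λ) ⊕ Control Q

/-- The internal states of the combined machine: those of the two machines, and a register. -/
abbrev Cσ : Type := (∀ i, (tm i).σ) × Option Symbol

/-- The statements of the combined machine. -/
abbrev CStmt (Q : Type) : Type := Stmt (CΓ tm) (CΛ tm Q) (Cσ tm)

variable {tm} {Q : Type}

/-- Translation of the statements of the machine `tm i`, with `halt` replaced by a jump. -/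
def liftStmt (exit : CΛ tm Q) (i : Bool) :
    Stmt (tm i).Γ (tm i).Λ (tm i).σ → CStmt tm Q
  | .push k f q => .push (.inl ⟨i, k⟩) (fun v => f (v.1 i)) (liftStmt exit i q)
  | .peek k f q => .peek (.inl ⟨i, k⟩)
      (fun v o => (Function.update v.1 i (f (v.1 i) o), v.2)) (liftStmt exit i q)
  | .pop k f q => .pop (.inl ⟨i, k⟩)
      (fun v o => (Function.update v.1 i (f (v.1 i) o), v.2)) (liftStmt exit i q)
  | .load f q => .load (fun v => (Function.update v.1 i (f (v.1 i)), v.2)) (liftStmt exit i q)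
  | .branch f q₁ q₂ => .branch (fun v => f (v.1 i)) (liftStmt exit i q₁) (liftStmt exit i q₂)
  | .goto f => .goto fun v => .inl ⟨i, f (v.1 i)⟩
  | .halt => .goto fun _ => exit

/-- The stacks of the combined machine. -/
def joinStk (S : ∀ i k, List ((tm i).Γ k)) (x : List Bool) (w o : List Symbol) :
    ∀ k, List (CΓ tm k)
  | .inl ⟨i, k⟩ => S i k
  | .inr .input => x
  | .inr .work => w
  | .inr .output => o

theorem update_joinStk_inl (S : ∀ i k, List ((tm i).Γ k)) (x : List Bool) (w o : List Symbol)
    (i : Bool) (k : (tm i).K) (l : List ((tm i).Γ k)) :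
    Function.update (joinStk S x w o) (.inl ⟨i, k⟩) l =
      joinStk (Function.update S i (Function.update (S i) k l)) x w o := by
  funext k'
  match k' with
  | .inl ⟨j, k'⟩ =>
    by_cases hj : j = i
    · subst hj
      by_cases hk : k' = k
      · subst hk; simp [joinStk]
      · have : (Sum.inl ⟨j, k'⟩ : CStack tm) ≠ .inl ⟨j, k⟩ := by
          intro h; simp at h; exact hk h
        rw [Function.update_of_ne this]
        simp [joinStk, hk]
    · have : (Sum.inl ⟨j, k'⟩ : CStack tm) ≠ .inl ⟨i, k⟩ := by
        intro h; simp at h; exact hj h.1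
      rw [Function.update_of_ne this]
      simp [joinStk, hj]
  | .inr .input => rfl
  | .inr .work => rfl
  | .inr .output => rfl

theorem update_joinStk_input (S : ∀ i k, List ((tm i).Γ k)) (x x' : List Bool)
    (w o : List Symbol) :
    Function.update (joinStk S x w o) (.inr .input) x' = joinStk S x' w o := by
  funext k'
  match k' with
  | .inl ⟨j, k'⟩ => rfl
  | .inr .input => rfl
  | .inr .work => rfl
  | .inr .output => rfl

theorem update_joinStk_work (S : ∀ i k, List ((tm i).Γ k)) (x : List Bool)
    (w w' o : List Symbol) :
    Function.update (joinStk S x w o) (.inr .work) w' = joinStk S x w' o := by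
  funext k'
  match k' with
  | .inl ⟨j, k'⟩ => rfl
  | .inr .input => rfl
  | .inr .work => rfl
  | .inr .output => rfl

theorem update_joinStk_output (S : ∀ i k, List ((tm i).Γ k)) (x : List Bool)
    (w o o' : List Symbol) :
    Function.update (joinStk S x w o) (.inr .output) o' = joinStk S x w o' := by
  funext k'
  match k' with
  | .inl ⟨j, k'⟩ => rfl
  | .inr .input => rfl
  | .inr .work => rfl
  | .inr .output => rfl

/-- A lifted statement touches only component `i` of the states and stacks. Halting is the label
`none`, which `Option.elim` sends to `exit`; replacing `halt` by a jump keeps the number of steps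
exact. -/
theorem stepAux_liftStmt (exit : CΛ tm Q) (i : Bool) (q : Stmt (tm i).Γ (tm i).Λ (tm i).σ)
    (V : ∀ i, (tm i).σ) (r : Option Symbol) (S : ∀ i k, List ((tm i).Γ k)) (x : List Bool)
    (w o : List Symbol) :
    stepAux (liftStmt exit i q) (V, r) (joinStk S x w o) =
      ⟨some ((stepAux q (V i) (S i)).l.elim exit fun l => .inl ⟨i, l⟩),
        (Function.update V i (stepAux q (V i) (S i)).var, r),
        joinStk (Function.update S i (stepAux q (V i) (S i)).stk) x w o⟩ := by
  induction q generalizing V S with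
  | push k f q ih =>
    rw [liftStmt, stepAux, stepAux, update_joinStk_inl, ih]
    simp [joinStk]
  | peek k f q ih =>
    rw [liftStmt, stepAux, stepAux, ih]
    simp [joinStk]
  | pop k f q ih =>
    rw [liftStmt, stepAux, stepAux, update_joinStk_inl, ih]
    simp [joinStk]
  | load f q ih =>
    rw [liftStmt, stepAux, stepAux, ih]
    simp
  | branch f q₁ q₂ ih₁ ih₂ =>
    rw [liftStmt, stepAux, stepAux]
    cases h : f (V i)
    · simp only [cond_false]; exact ih₂ V S
    · simp only [cond_true]; exact ih₁ V S
  | goto f => simp [liftStmt]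
  | halt => simp [liftStmt]

theorem runsIn_lift {M : CΛ tm Q → CStmt tm Q} (exit : CΛ tm Q) (i : Bool)
    (hM : ∀ l, M (.inl ⟨i, l⟩) = liftStmt exit i ((tm i).m l))
    (x : List Bool) (w o : List Symbol) (r : Option Symbol) (t : ℕ) (c c' : (tm i).Cfg)
    (h : RunsIn (tm i).step t c c') (V : ∀ i, (tm i).σ) (S : ∀ i k, List ((tm i).Γ k)) :
    RunsIn (TM2.step M) t
      ⟨some (c.l.elim exit fun l => .inl ⟨i, l⟩), (Function.update V i c.var, r),
        joinStk (Function.update S i c.stk) x w o⟩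
      ⟨some (c'.l.elim exit fun l => .inl ⟨i, l⟩), (Function.update V i c'.var, r),
        joinStk (Function.update S i c'.stk) x w o⟩ := by
  induction t generalizing c with
  | zero => cases h; exact RunsIn.refl _ _
  | succ t ih =>
    obtain ⟨b, hb, h⟩ := h.exists_head
    refine RunsIn.head ?_ (ih b h)
    obtain ⟨l, v, S'⟩ := c
    cases l with
    | none => simp [FinTM2.step, TM2.step] at hb
    | some l =>
      have hb : stepAux ((tm i).m l) v S' = b := Option.some.inj hb
      subst hb
      simp only [Option.elim_some, TM2.step, hM, stepAux_liftStmt, Function.update_self,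
        Function.update_idem]

/-- Push the symbols of `l` on the work stack, then jump to `exit`. -/
def pushWork (exit : CΛ tm Q) : List Symbol → CStmt tm Q
  | [] => .goto fun _ => exit
  | a :: l => .push (.inr .work) (fun _ => a) (pushWork exit l)

theorem stepAux_pushWork (exit : CΛ tm Q) (l : List Symbol) (v : Cσ tm)
    (S : ∀ i k, List ((tm i).Γ k)) (x : List Bool) (w o : List Symbol) :
    stepAux (pushWork exit l) v (joinStk S x w o) =
      ⟨some exit, v, joinStk S x (l.reverse ++ w) o⟩ := by
  induction l generalizing w with
  | nil => simp [pushWork]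
  | cons a l ih =>
    rw [pushWork, stepAux, update_joinStk_work, ih]
    simp [joinStk]

end Combine


/-! ### The program of the combined machine and its run. -/

section Combine

variable {tm : Bool → FinTM2} {Q : Type}

/-- The program of the combined machine: copy the input to both machines, run both, and feed their
outputs to the transducer. -/
def combineProgram (inp : ∀ i, (tm i).Γ (tm i).k₀) (dec : ∀ i, (tm i).Γ (tm i).k₁ ≃ Symbol)
    (T : Transducer Q) : CΛ tm Q → CStmt tm Q
  | .inl ⟨false, l⟩ => liftStmt (.inl ⟨true, (tm true).main⟩) false ((tm false).m l)
  | .inl ⟨true, l⟩ => liftStmt (.inr (.read false T.start)) true ((tm true).m l)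
  | .inr .copy =>
      -- The register only records whether a symbol was popped; `tick` stands for any input bit.
      .pop (.inr .input) (fun v o => (v.1, o.map fun _ => Symbol.tick)) <|
      .branch (fun v => v.2.isSome)
        (.push (.inl ⟨false, (tm false).k₀⟩) (fun _ => inp false) <|
          .push (.inl ⟨true, (tm true).k₀⟩) (fun _ => inp true) <|
          .goto fun _ => .inr .copy)
        (.goto fun _ => .inl ⟨false, (tm false).main⟩)
  | .inr (.read i q) =>
      .pop (.inl ⟨i, (tm i).k₁⟩) (fun v o => (v.1, o.map (dec i))) <|
      .branch (fun v => v.2.isSome)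
        -- The default `.tick` is never used: the branch has just found the register nonempty.
        (.goto fun v => .inr (.emit i q (v.2.getD .tick)))
        (.goto fun _ => .inr (if i then .write else .read true q))
  | .inr (.emit i q a) => pushWork (.inr (.read i (T.next q i a))) (T.out q i a)
  | .inr .write =>
      .pop (.inr .work) (fun v o => (v.1, o)) <|
      .branch (fun v => v.2.isSome)
        (.push (.inr .output) (fun v => v.2.getD .tick) <| .goto fun _ => .inr .write)
        .halt

variable (inp : ∀ i, (tm i).Γ (tm i).k₀) (dec : ∀ i, (tm i).Γ (tm i).k₁ ≃ Symbol)
  (T : Transducer Q)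

/-- `m` counts the symbols already copied and exists for the induction. The input is unary, so the
reversal caused by copying a stack does not matter. The extra step is the pop of the empty stack. -/
theorem runsIn_copy (n m : ℕ) (V : ∀ i, (tm i).σ) (r : Option Symbol) :
    RunsIn (TM2.step (combineProgram inp dec T)) (n + 1)
      ⟨some (.inr .copy), (V, r),
        joinStk (fun i => oneStack (tm i) (tm i).k₀ (List.replicate m (inp i)))
          (List.replicate n true) [] []⟩
      ⟨some (.inl ⟨false, (tm false).main⟩), (V, none),
        joinStk (fun i => oneStack (tm i) (tm i).k₀ (List.replicate (m + n) (inp i))) [] [] []⟩ := by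
  induction n generalizing m r with
  | zero =>
    refine RunsIn.single ?_
    simp only [TM2.step, combineProgram, stepAux, joinStk, update_joinStk_input, List.replicate_zero]
    rfl
  | succ n ih =>
    refine RunsIn.head ?_ (by simpa [add_assoc, add_comm 1] using ih (m + 1) (some .tick))
    simp only [TM2.step, combineProgram, stepAux, joinStk, update_joinStk_input,
      update_joinStk_inl, List.replicate_succ, List.head?_cons, Option.map_some,
      Option.isSome_some, cond_true, List.tail_cons]
    congr 3
    funext i
    cases i <;> simp [oneStack]

/-- Each symbol costs two steps, one to pop it and one to emit, and a last pop finds the stack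
empty. The work stack collects the output in reverse; the `write` phase undoes this. -/
theorem runsIn_read (i : Bool) (q : Q) (u : List Symbol) (S : ∀ i k, List ((tm i).Γ k))
    (w : List Symbol) (V : ∀ i, (tm i).σ) (r : Option Symbol) :
    RunsIn (TM2.step (combineProgram inp dec T)) (2 * u.length + 1)
      ⟨some (.inr (.read i q)), (V, r),
        joinStk (Function.update S i (oneStack (tm i) (tm i).k₁ (u.map (dec i).symm))) [] w []⟩
      ⟨some (.inr (if i then .write else .read true (T.stateAfter i q u))), (V, none),
        joinStk (Function.update S i fun _ => []) [] ((T.output i q u).reverse ++ w) []⟩ := by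
  induction u generalizing q w r with
  | nil =>
    refine RunsIn.single ?_
    simp only [TM2.step, combineProgram, stepAux, joinStk, update_joinStk_inl]
    simp [oneStack, Transducer.output, Transducer.stateAfter]
  | cons a u ih =>
    have h := ih (T.next q i a) ((T.out q i a).reverse ++ w) (some a)
    rw [← List.append_assoc, ← List.reverse_append] at h
    refine RunsIn.head (b := ⟨some (.inr (.emit i q a)), (V, some a),
      joinStk (Function.update S i (oneStack (tm i) (tm i).k₁ (u.map (dec i).symm))) [] w []⟩)
      ?_ (RunsIn.head ?_ h)
    · simp only [TM2.step, combineProgram, stepAux, joinStk, update_joinStk_inl]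
      simp [oneStack]
    · simp only [TM2.step, combineProgram, stepAux_pushWork]

theorem runsIn_write (w o : List Symbol) (S : ∀ i k, List ((tm i).Γ k)) (V : ∀ i, (tm i).σ)
    (r : Option Symbol) :
    RunsIn (TM2.step (combineProgram inp dec T)) (w.length + 1)
      ⟨some (.inr .write), (V, r), joinStk S [] w o⟩
      ⟨none, (V, none), joinStk S [] [] (w.reverse ++ o)⟩ := by
  induction w generalizing o r with
  | nil =>
    refine RunsIn.single ?_
    simp only [TM2.step, combineProgram, stepAux, joinStk, update_joinStk_work]
    rfl
  | cons a w ih =>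
    refine RunsIn.head ?_ (by simpa using ih (a :: o) (some a))
    simp only [TM2.step, combineProgram, stepAux, joinStk, update_joinStk_work,
      update_joinStk_output, List.head?_cons, Option.isSome_some, cond_true, List.tail_cons]
    simp

/-- The combined machine. -/
def combineTM [Fintype Q] (inp : ∀ i, (tm i).Γ (tm i).k₀)
    (dec : ∀ i, (tm i).Γ (tm i).k₁ ≃ Symbol) (T : Transducer Q) : FinTM2 :=
  letI := fun i => (tm i).kFin
  letI := fun i => (tm i).ΛFin
  letI := fun i => (tm i).σFin
  { K := CStack tm
    k₀ := .inr .input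
    k₁ := .inr .output
    Γ := CΓ tm
    Λ := CΛ tm Q
    main := .inr .copy
    σ := Cσ tm
    initialState := (fun i => (tm i).initialState, none)
    Γk₀Fin := inferInstanceAs (Fintype Bool)
    m := combineProgram inp dec T }

/-- The five phases are chained. A final configuration must have the initial internal state and no
nonempty stack except the output; the two machines clean up after themselves because their own final
configurations obey the same rule. -/
theorem runsIn_combineTM [Fintype Q] (n : ℕ) (u : Bool → List Symbol) (t : Bool → ℕ)
    (h : ∀ i, RunsIn (tm i).step (t i) (initList (tm i) (List.replicate n (inp i)))
      (haltList (tm i) ((u i).map (dec i).symm))) :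
    RunsIn (combineTM inp dec T).step
      (n + 1 + t false + t true + (2 * (u false).length + 1) + (2 * (u true).length + 1) +
        ((T.eval (u false) (u true)).length + 1))
      (initList (combineTM inp dec T) (List.replicate n true))
      (haltList (combineTM inp dec T) (T.eval (u false) (u true))) := by
  have hS : ∀ S : ∀ i k, List ((tm i).Γ k), ∀ i, Function.update S i (S i) = S := fun S i => by simp
  have hV : ∀ i, Function.update (fun i => (tm i).initialState) i (tm i).initialState =
      fun i => (tm i).initialState := fun i => by simp
  have hempty : ∀ i, oneStack (tm i) (tm i).k₀ (List.replicate 0 (inp i)) = fun _ => [] :=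
    fun i => by simp [oneStack]
  have hinit : initList (combineTM inp dec T) (List.replicate n true) =
      ⟨some (.inr .copy), (fun i => (tm i).initialState, none),
        joinStk (fun i => oneStack (tm i) (tm i).k₀ (List.replicate 0 (inp i)))
          (List.replicate n true) [] []⟩ := by
    simp only [hempty]
    refine congrArg (Cfg.mk _ _) ?_
    funext k
    match k with
    | .inl ⟨i, k⟩ => rfl
    | .inr .input => rfl
    | .inr .work => rfl
    | .inr .output => rfl
  have hhalt : haltList (combineTM inp dec T) (T.eval (u false) (u true)) =
      ⟨none, (fun i => (tm i).initialState, none),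
        joinStk (fun _ _ => []) [] [] (T.eval (u false) (u true))⟩ := by
    refine congrArg (Cfg.mk _ _) ?_
    funext k
    match k with
    | .inl ⟨i, k⟩ => rfl
    | .inr .input => rfl
    | .inr .work => rfl
    | .inr .output => rfl
  rw [hinit, hhalt]
  set V : ∀ i, (tm i).σ := fun i => (tm i).initialState
  have h₀ := runsIn_copy inp dec T n 0 V none
  rw [zero_add] at h₀
  set S₀ : ∀ i k, List ((tm i).Γ k) :=
    fun i => oneStack (tm i) (tm i).k₀ (List.replicate n (inp i))
  have h₁ := runsIn_lift (M := combineProgram inp dec T) (.inl ⟨true, (tm true).main⟩) false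
    (fun _ => rfl) [] [] [] none _ _ _ (h false) V S₀
  rw [initList_eq, haltList_eq] at h₁
  have hS₀ : Function.update S₀ false
      (oneStack (tm false) (tm false).k₀ (List.replicate n (inp false))) = S₀ := hS S₀ false
  simp only [Option.elim_some, Option.elim_none, hV false, hS₀] at h₁
  set S₁ := Function.update S₀ false (oneStack (tm false) (tm false).k₁ ((u false).map (dec false).symm))
  have h₂ := runsIn_lift (M := combineProgram inp dec T) (.inr (.read false T.start)) true
    (fun _ => rfl) [] [] [] none _ _ _ (h true) V S₁
  rw [initList_eq, haltList_eq] at h₂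
  have hS₁ : Function.update S₁ true
      (oneStack (tm true) (tm true).k₀ (List.replicate n (inp true))) = S₁ := hS S₁ true
  simp only [Option.elim_some, Option.elim_none, hV true, hS₁] at h₂
  set S₂ := Function.update S₁ true (oneStack (tm true) (tm true).k₁ ((u true).map (dec true).symm))
  have h₃ := runsIn_read inp dec T false T.start (u false) S₂ [] V none
  have hS₂ : Function.update S₂ false
      (oneStack (tm false) (tm false).k₁ ((u false).map (dec false).symm)) = S₂ := hS S₂ false
  rw [hS₂] at h₃
  set S₃ := Function.update S₂ false fun _ => []
  have h₄ := runsIn_read inp dec T true (T.stateAfter false T.start (u false)) (u true) S₃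
    ((T.output false T.start (u false)).reverse ++ []) V none
  have hS₃ : Function.update S₃ true
      (oneStack (tm true) (tm true).k₁ ((u true).map (dec true).symm)) = S₃ := hS S₃ true
  rw [hS₃] at h₄
  have hS₄ : (Function.update S₃ true fun _ => []) = fun _ _ => [] := by
    funext i
    cases i <;> simp [S₃]
  rw [hS₄, List.append_nil, ← List.reverse_append] at h₄
  have h₅ := runsIn_write inp dec T (T.eval (u false) (u true)).reverse [] (fun _ _ => []) V none
  rw [List.reverse_reverse, List.append_nil, List.length_reverse] at h₅
  rw [List.append_nil] at h₃
  exact ((((h₀.trans h₁).trans h₂).trans h₃).trans h₄).trans h₅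

/-- Polynomial-time computable functions are closed under finite transducers with two inputs. -/
theorem PolyTime.transduce {f g : ℕ+ → List Symbol} (hf : PolyTime f) (hg : PolyTime g)
    {Q : Type} [Fintype Q] (T : Transducer Q) : PolyTime fun lam => T.eval (f lam) (g lam) := by
  obtain ⟨F⟩ := hf
  obtain ⟨G⟩ := hg
  obtain ⟨C, hC⟩ := length_le_of_runsIn F.tm
  obtain ⟨D, hD⟩ := length_le_of_runsIn G.tm
  obtain ⟨L, hL⟩ := T.exists_length_output_le
  let tm : Bool → FinTM2 := fun i => bif i then G.tm else F.tm
  let inp : ∀ i, (tm i).Γ (tm i).k₀ := fun i => match i with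
    | false => F.inputAlphabet.symm true
    | true => G.inputAlphabet.symm true
  let dec : ∀ i, (tm i).Γ (tm i).k₁ ≃ Symbol := fun i => match i with
    | false => F.outputAlphabet
    | true => G.outputAlphabet
  -- `PF` and `PG` bound the lengths of the two outputs, which govern the cost of the reading and
  -- writing phases.
  let PF : Polynomial ℕ := Polynomial.X + Polynomial.C C * F.time
  let PG : Polynomial ℕ := Polynomial.X + Polynomial.C D * G.time
  refine ⟨⟨⟨combineTM inp dec T, Equiv.refl _, Equiv.refl _⟩,
    Polynomial.X + 1 + F.time + G.time + (2 * PF + 1) + (2 * PG + 1) +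
      (Polynomial.C L * PF + Polynomial.C L * PG + 1), fun lam => Classical.choice ?_⟩⟩
  have hu := unaryEncodeNat_eq_replicate (lam : ℕ)
  have hF := F.outputsFun lam
  have hG := G.outputsFun lam
  have hlen : (unaryEncodeNat (lam : ℕ)).length = lam := by simp [hu]
  have hFr : RunsIn F.tm.step hF.steps
      (initList F.tm (List.replicate lam (F.inputAlphabet.symm true)))
      (haltList F.tm ((f lam).map F.outputAlphabet.symm)) := by
    have := hF.evals_in_steps
    simp only [hu, List.map_replicate] at this
    exact this
  have hGr : RunsIn G.tm.step hG.steps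
      (initList G.tm (List.replicate lam (G.inputAlphabet.symm true)))
      (haltList G.tm ((g lam).map G.outputAlphabet.symm)) := by
    have := hG.evals_in_steps
    simp only [hu, List.map_replicate] at this
    exact this
  have hFt : hF.steps ≤ F.time.eval (lam : ℕ) := by simpa [hlen] using hF.steps_le_m
  have hGt : hG.steps ≤ G.time.eval (lam : ℕ) := by simpa [hlen] using hG.steps_le_m
  have hFl : (f lam).length ≤ PF.eval (lam : ℕ) := by
    have := hC _ _ _ hFr
    simp only [List.length_map, List.length_replicate] at this
    simpa [PF] using this.trans (Nat.add_le_add_left (Nat.mul_le_mul_left C hFt) _)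
  have hGl : (g lam).length ≤ PG.eval (lam : ℕ) := by
    have := hD _ _ _ hGr
    simp only [List.length_map, List.length_replicate] at this
    simpa [PG] using this.trans (Nat.add_le_add_left (Nat.mul_le_mul_left D hGt) _)
  obtain ⟨N, hN, hrun⟩ : ∃ N, N = _ ∧ RunsIn _ N _ _ := ⟨_, rfl, runsIn_combineTM (tm := tm) inp dec T lam
    (fun i => bif i then g lam else f lam) (fun i => bif i then hG.steps else hF.steps)
    (fun i => match i with
      | false => hFr
      | true => hGr)⟩
  have e₁ : (unaryEncodeNat (lam : ℕ)).map (Equiv.refl Bool).invFun = List.replicate lam true :=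
    (List.map_id _).trans hu
  have e₂ : (T.eval (f lam) (g lam)).map (Equiv.refl Symbol).invFun = T.eval (f lam) (g lam) :=
    List.map_id _
  have hrun' : RunsIn (combineTM inp dec T).step N
      (initList (combineTM inp dec T) ((unaryEncodeNat (lam : ℕ)).map (Equiv.refl Bool).invFun))
      (haltList (combineTM inp dec T)
        ((T.eval (f lam) (g lam)).map (Equiv.refl Symbol).invFun)) := by
    have hcongr : ∀ (x y : List Bool) (z w : List Symbol), x = y → z = w →
        RunsIn (combineTM inp dec T).step N (initList (combineTM inp dec T) y)
          (haltList (combineTM inp dec T) w) →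
        RunsIn (combineTM inp dec T).step N (initList (combineTM inp dec T) x)
          (haltList (combineTM inp dec T) z) := by
      rintro x _ z _ rfl rfl h
      exact h
    exact hcongr _ _ _ _ e₁ e₂ hrun
  refine ⟨⟨N, hrun'⟩, ?_⟩
  · rw [hlen]
    have h₁ : (T.eval (f lam) (g lam)).length ≤ L * PF.eval (lam : ℕ) + L * PG.eval (lam : ℕ) := by
      rw [Transducer.eval, List.length_append]
      exact Nat.add_le_add ((hL _ _ _).trans (Nat.mul_le_mul_left L hFl))
        ((hL _ _ _).trans (Nat.mul_le_mul_left L hGl))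
    simp only [Polynomial.eval_add, Polynomial.eval_mul, Polynomial.eval_X, Polynomial.eval_one,
      Polynomial.eval_C, Polynomial.eval_ofNat, hN, cond_true, cond_false]
    omega

end Combine

/-! ### Closure properties of the class of polynomial-time computable functions -/

namespace PolyTime

theorem append {f g : ℕ+ → List Symbol} (hf : PolyTime f) (hg : PolyTime g) :
    PolyTime fun lam => f lam ++ g lam := by
  let T : Transducer Unit := ⟨(), fun _ _ _ => (), fun _ _ a => [a]⟩
  have h : ∀ i q w, T.output i q w = w := by
    intro i q w
    induction w with
    | nil => rfl
    | cons a w ih => rw [Transducer.output, ih]; rfl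
  simpa only [Transducer.eval, h] using hf.transduce hg T

/-- Closure under finite transducers with one input. -/
theorem transduce_single {f : ℕ+ → List Symbol} (hf : PolyTime f) {Q : Type} [Fintype Q] (start : Q)
    (next : Q → Symbol → Q) (out : Q → Symbol → List Symbol) {g : ℕ+ → List Symbol}
    (hg : ∀ lam, (⟨start, fun q _ a => next q a, fun q i a => bif i then [] else out q a⟩ :
      Transducer Q).output false start (f lam) = g lam) : PolyTime g := by
  have h := hf.transduce hf
    ⟨start, fun q _ a => next q a, fun q i a => bif i then [] else out q a⟩
  have hnil : ∀ q w, (⟨start, fun q _ a => next q a, fun q i a => bif i then [] else out q a⟩ :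
      Transducer Q).output true q w = [] := by
    intro q w
    induction w generalizing q with
    | nil => rfl
    | cons a w ih => rw [Transducer.output, ih]; rfl
  simpa only [Transducer.eval, hnil, List.append_nil, hg] using h

/-- A transducer writes only when it reads a symbol, so a nonempty word is needed to trigger the
output of `c` at its first letter. -/
theorem const {f : ℕ+ → List Symbol} (hf : PolyTime f) (hne : ∀ lam, f lam ≠ [])
    (c : List Symbol) : PolyTime fun _ => c := by
  refine hf.transduce_single false (fun _ _ => true) (fun q _ => bif q then [] else c) fun lam => ?_
  obtain ⟨a, w, hw⟩ := List.exists_cons_of_ne_nil (hne lam)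
  rw [hw, Transducer.output]
  have h : ∀ w, (⟨false, fun _ _ _ => true, fun q i _ => bif i then [] else bif q then [] else c⟩ :
      Transducer Bool).output false true w = [] := by
    intro w
    induction w with
    | nil => rfl
    | cons a w ih => rw [Transducer.output, ih]; rfl
  rw [h]
  simp

/-- The number of repetitions does not depend on the security parameter. Constant message size
enters the efficiency proof here. -/
theorem flatten_replicate {f : ℕ+ → List Symbol} (hf : PolyTime f) (hne : ∀ lam, f lam ≠ [])
    (n : ℕ) : PolyTime fun lam => (List.replicate n (f lam)).flatten := by
  induction n with
  | zero => exact hf.const hne []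
  | succ n ih => simpa only [List.replicate_succ, List.flatten_cons] using hf.append ih

theorem tail {f : ℕ+ → List Symbol} (hf : PolyTime f) : PolyTime fun lam => (f lam).tail := by
  refine hf.transduce_single false (fun _ _ => true) (fun q a => bif q then [a] else []) fun lam => ?_
  have h : ∀ w, (⟨false, fun _ _ _ => true, fun q i a => bif i then [] else bif q then [a] else []⟩ :
      Transducer Bool).output false true w = w := by
    intro w
    induction w with
    | nil => rfl
    | cons a w ih => rw [Transducer.output, ih]; rfl
  cases f lam with
  | nil => rfl
  | cons a w => rw [Transducer.output, h]; rfl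

theorem drop {f : ℕ+ → List Symbol} (hf : PolyTime f) (n : ℕ) :
    PolyTime fun lam => (f lam).drop n := by
  induction n with
  | zero => simpa using hf
  | succ n ih => simpa only [List.tail_drop] using ih.tail

end PolyTime

/-- A word of ticks. -/
def ticks (n : ℕ) : List Symbol := List.replicate n Symbol.tick

theorem describeNat_eq (n : ℕ) : describeNat n = ticks n ++ [Symbol.stop_mark] := rfl

theorem ticks_add (m n : ℕ) : ticks (m + n) = ticks m ++ ticks n :=
  List.replicate_add m n Symbol.tick

/-- The state of the transducers that read the header of a circuit description. -/
def headerNext : Fin 3 → Symbol → Fin 3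
  | 0, .stop_mark => 1
  | 1, .stop_mark => 2
  | q, _ => q

/-- The output of the transducer that selects a part of a circuit description. -/
def headerOut (j : Fin 3) : Fin 3 → Symbol → List Symbol
  | 2, a => if j = 2 then [a] else []
  | _, .stop_mark => []
  | q, a => if q = j then [a] else []

/-- The transducer that selects the number of inputs (`j = 0`), the number of outputs (`j = 1`) or
the gates (`j = 2`) from a circuit description. -/
def headerTransducer (j : Fin 3) : Transducer (Fin 3) :=
  ⟨0, fun q _ a => headerNext q a, fun q i a => bif i then [] else headerOut j q a⟩

theorem headerTransducer_output_ticks (j q : Fin 3) (n : ℕ) (w : List Symbol) :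
    (headerTransducer j).output false q (ticks n ++ w) =
      (if q = j then ticks n else []) ++ (headerTransducer j).output false q w := by
  induction n with
  | zero => simp [ticks]
  | succ n ih =>
    rw [ticks, List.replicate_succ, List.cons_append, Transducer.output]
    have hn : (headerTransducer j).next q false Symbol.tick = q := by
      fin_cases q <;> rfl
    have ho : (headerTransducer j).out q false Symbol.tick =
        if q = j then [Symbol.tick] else [] := by
      fin_cases q <;> simp [headerTransducer, headerOut, eq_comm]
    rw [hn, ho, ← ticks, ih]
    split_ifs <;> simp

theorem headerTransducer_output_gates (j : Fin 3) (w : List Symbol) :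
    (headerTransducer j).output false 2 w = if j = 2 then w else [] := by
  induction w with
  | nil => simp [Transducer.output]
  | cons a w ih =>
    rw [Transducer.output]
    have hn : (headerTransducer j).next 2 false a = 2 := by
      cases a <;> rfl
    have ho : (headerTransducer j).out 2 false a = if j = 2 then [a] else [] := by
      cases a <;> rfl
    rw [hn, ho, ih]
    split_ifs <;> simp

/-- The state counts end markers up to two. State 2 is absorbing, so later markers inside the gate
words are treated as ordinary letters. -/
theorem headerTransducer_output_describe (j : Fin 3) {a b : ℕ} (C : Circuit a b) :
    (headerTransducer j).output false 0 C.describe =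
      (if j = 0 then ticks a else []) ++ (if j = 1 then ticks b else []) ++
        (if j = 2 then C.describeGates else []) := by
  rw [Circuit.describe, describeNat_eq, describeNat_eq, List.append_assoc, List.append_assoc,
    List.append_assoc, headerTransducer_output_ticks, List.singleton_append, Transducer.output]
  have h₀ : (headerTransducer j).next 0 false Symbol.stop_mark = 1 := rfl
  have h₁ : (headerTransducer j).next 1 false Symbol.stop_mark = 2 := rfl
  have o₀ : (headerTransducer j).out 0 false Symbol.stop_mark = [] := rfl
  have o₁ : (headerTransducer j).out 1 false Symbol.stop_mark = [] := rfl
  rw [h₀, o₀, List.nil_append, headerTransducer_output_ticks, List.singleton_append,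
    Transducer.output, h₁, o₁, headerTransducer_output_gates]
  simp [eq_comm]

namespace PolyTimeUniform

variable {a b : ℕ+ → ℕ} {C : ∀ lam : ℕ+, Circuit (a lam) (b lam)}

theorem polyTime_header (h : PolyTimeUniform C) (j : Fin 3) :
    PolyTime fun lam => (if j = 0 then ticks (a lam) else []) ++
      (if j = 1 then ticks (b lam) else []) ++ (if j = 2 then (C lam).describeGates else []) :=
  PolyTime.transduce_single (f := fun lam => (C lam).describe) h 0 headerNext (headerOut j)
    fun lam => headerTransducer_output_describe j (C lam)

theorem polyTime_inputs (h : PolyTimeUniform C) : PolyTime fun lam => ticks (a lam) := by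
  simpa using h.polyTime_header 0

theorem polyTime_outputs (h : PolyTimeUniform C) : PolyTime fun lam => ticks (b lam) := by
  simpa using h.polyTime_header 1

theorem polyTime_gates (h : PolyTimeUniform C) : PolyTime fun lam => (C lam).describeGates := by
  simpa using h.polyTime_header 2

theorem polyTime_const (h : PolyTimeUniform C) (c : List Symbol) : PolyTime fun _ => c :=
  PolyTime.const (f := fun lam => (C lam).describe) h
    (fun lam => by simp [Circuit.describe, describeNat]) c

theorem of_polyTime (ha : PolyTime fun lam => describeNat (a lam))
    (hb : PolyTime fun lam => describeNat (b lam))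
    (hC : PolyTime fun lam => (C lam).describeGates) : PolyTimeUniform C :=
  (ha.append hb).append hC

end PolyTimeUniform

/-! ### Composition of circuits -/

/-- The sequential composition of circuits. -/
def Circuit.append : {a b c : ℕ} → Circuit a b → Circuit b c → Circuit a c
  | _, _, _, .nil _, D => D
  | _, _, _, .cons g C, D => .cons g (C.append D)

/-- Transport of a circuit along equalities of sizes. -/
def Circuit.cast {a b a' b' : ℕ} (ha : a = a') (hb : b = b') (C : Circuit a b) : Circuit a' b' :=
  ha ▸ hb ▸ C

/-- The `t`-fold repetition of a circuit. -/
def Circuit.repeat {N : ℕ} (C : Circuit N N) : ℕ → Circuit N N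
  | 0 => .nil N
  | t + 1 => C.append (C.repeat t)

/-- A gate acting on the first qubits of a longer list. -/
def Gate.embed (r : ℕ) : {a b : ℕ} → Gate a b → Gate (r + a) (r + b)
  | _, _, .hadamard i => .hadamard ⟨i, by omega⟩
  | _, _, .phase i => .phase ⟨i, by omega⟩
  | _, _, .cnot c t h => .cnot ⟨c, by omega⟩ ⟨t, by omega⟩ (by simpa [Fin.ext_iff] using h)
  | _, _, .toffoli c₁ c₂ t h₁₂ h₁ h₂ => .toffoli ⟨c₁, by omega⟩ ⟨c₂, by omega⟩ ⟨t, by omega⟩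
      (by simpa [Fin.ext_iff] using h₁₂) (by simpa [Fin.ext_iff] using h₁)
      (by simpa [Fin.ext_iff] using h₂)
  | _, _, .aux (n := n) i => .aux (n := r + n) ⟨i, by omega⟩
  | _, _, .discard (n := n) i => .discard (n := r + n) ⟨i, by omega⟩

/-- A circuit acting on the first qubits of a longer list. -/
def Circuit.embed (r : ℕ) : {a b : ℕ} → Circuit a b → Circuit (r + a) (r + b)
  | _, _, .nil n => .nil (r + n)
  | _, _, .cons g C => .cons (g.embed r) (C.embed r)

theorem Circuit.describeGates_append {a b c : ℕ} (C : Circuit a b) (D : Circuit b c) :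
    (C.append D).describeGates = C.describeGates ++ D.describeGates := by
  induction C with
  | nil => rfl
  | cons g C ih => simp [Circuit.append, Circuit.describeGates, ih]

theorem Circuit.describeGates_cast {a b a' b' : ℕ} (ha : a = a') (hb : b = b')
    (C : Circuit a b) : (C.cast ha hb).describeGates = C.describeGates := by
  subst ha hb; rfl

theorem Circuit.describeGates_repeat {N : ℕ} (C : Circuit N N) (t : ℕ) :
    (C.repeat t).describeGates = (List.replicate t C.describeGates).flatten := by
  induction t with
  | zero => rfl
  | succ t ih => simp [Circuit.repeat, describeGates_append, ih, List.replicate_succ]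

/-- Positions are counted from the front, so idle qubits appended at the end change no index. This
is why the attack always brings the qubits of a given circuit to the front. Writing the sizes as `r
+ a` lets `r + (n + 1)` reduce to `(r + n) + 1`, as `aux` and `discard` require. -/
theorem Gate.describe_embed (r : ℕ) {a b : ℕ} (g : Gate a b) :
    (g.embed r).describe = g.describe := by
  cases g <;> rfl

theorem Circuit.describeGates_embed (r : ℕ) {a b : ℕ} (C : Circuit a b) :
    (C.embed r).describeGates = C.describeGates := by
  induction C with
  | nil => rfl
  | cons g C ih => simp [Circuit.embed, Circuit.describeGates, ih, Gate.describe_embed]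

theorem Circuit.toMap_append {a b c : ℕ} (C : Circuit a b) (D : Circuit b c) (ρ : Op a) :
    (C.append D).toMap ρ = D.toMap (C.toMap ρ) := by
  induction C with
  | nil => rfl
  | cons g C ih => simp [Circuit.append, Circuit.toMap, ih]

/-! ### Tensor products of operators, up to equality of sizes -/

/-- The first `a` bits of a bit string. -/
def leftBits {N a r : ℕ} (h : N = a + r) (x : Bits N) : Bits a := fun i => x ⟨i, by omega⟩

/-- The last `r` bits of a bit string. -/
def rightBits {N a r : ℕ} (h : N = a + r) (x : Bits N) : Bits r := fun i => x ⟨a + i, by omega⟩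

/-- The concatenation of bit strings. -/
def joinBits {N a r : ℕ} (h : N = a + r) (x : Bits a) (y : Bits r) : Bits N := fun i =>
  if hi : (i : ℕ) < a then x ⟨i, hi⟩ else y ⟨i - a, by omega⟩

/-- The tensor product of operators on the first `a` and on the last `r` of `N` qubits. -/
def tens {N a r : ℕ} (h : N = a + r) (X : Op a) (Y : Op r) : Op N := fun x y =>
  X (leftBits h x) (leftBits h y) * Y (rightBits h x) (rightBits h y)

section

variable {N a r : ℕ} (h : N = a + r)

@[simp] theorem leftBits_joinBits (x : Bits a) (y : Bits r) : leftBits h (joinBits h x y) = x := by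
  funext i; simp [leftBits, joinBits]

@[simp] theorem rightBits_joinBits (x : Bits a) (y : Bits r) :
    rightBits h (joinBits h x y) = y := by
  funext i; simp [rightBits, joinBits]

theorem joinBits_leftBits_rightBits (x : Bits N) :
    joinBits h (leftBits h x) (rightBits h x) = x := by
  funext i
  by_cases hi : (i : ℕ) < a
  · simp [leftBits, joinBits, hi]
  · simp only [rightBits, joinBits, hi, dite_false]
    congr 1; ext; simp; omega

/-- Splitting a bit string. -/
def splitBits : Bits N ≃ Bits a × Bits r where
  toFun x := (leftBits h x, rightBits h x)
  invFun p := joinBits h p.1 p.2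
  left_inv x := joinBits_leftBits_rightBits h x
  right_inv p := by simp

theorem ext_bits {x y : Bits N} (h₁ : leftBits h x = leftBits h y)
    (h₂ : rightBits h x = rightBits h y) : x = y := by
  rw [← joinBits_leftBits_rightBits h x, h₁, h₂, joinBits_leftBits_rightBits]

theorem eq_joinBits_iff {x : Bits N} {y : Bits a} {z : Bits r} :
    x = joinBits h y z ↔ leftBits h x = y ∧ rightBits h x = z := by
  constructor
  · rintro rfl; simp
  · rintro ⟨rfl, rfl⟩; exact (joinBits_leftBits_rightBits h x).symm

theorem sum_bits {M : Type*} [AddCommMonoid M] (f : Bits N → M) :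
    ∑ x, f x = ∑ y : Bits a, ∑ z : Bits r, f (joinBits h y z) := by
  rw [← (splitBits h).symm.sum_comp, Fintype.sum_prod_type]
  rfl

theorem joinBits_eq_append (x : Bits a) (y : Bits r) : joinBits rfl x y = Fin.append x y := by
  funext i
  refine Fin.addCases (fun j => ?_) (fun j => ?_) i
  · simp [joinBits]
  · simp [joinBits]

/-- `tens` takes the equality of sizes as an argument, so factors can be regrouped without
transporting operators along casts. This lemma ties it to the tensor product of the definitions. -/
theorem tensorOp_eq_tens (X : Op a) (Y : Op r) : tensorOp X Y = tens rfl X Y := by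
  ext x y
  rfl

theorem tens_mul (X X' : Op a) (Y Y' : Op r) :
    tens h X Y * tens h X' Y' = tens h (X * X') (Y * Y') := by
  ext x y
  simp only [Matrix.mul_apply, tens, sum_bits h, leftBits_joinBits, rightBits_joinBits,
    Finset.sum_mul_sum]
  refine Finset.sum_congr rfl fun _ _ => Finset.sum_congr rfl fun _ _ => by ring

theorem tens_conjTranspose (X : Op a) (Y : Op r) :
    (tens h X Y).conjTranspose = tens h X.conjTranspose Y.conjTranspose := by
  ext x y
  simp [tens]

theorem tens_single (x x' : Bits a) (y y' : Bits r) :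
    tens h (Matrix.single x x' 1) (Matrix.single y y' 1) =
      Matrix.single (joinBits h x y) (joinBits h x' y') 1 := by
  ext u v
  simp only [tens, Matrix.single_apply, eq_comm (a := joinBits h _ _), eq_joinBits_iff,
    eq_comm (a := x), eq_comm (a := x'), eq_comm (a := y), eq_comm (a := y')]
  split_ifs <;> simp_all

theorem conjBy_tens (U : Op a) (X : Op a) (Y : Op r) :
    conjBy (tens h U 1) (tens h X Y) = tens h (conjBy U X) Y := by
  simp [conjBy, tens_mul, tens_conjTranspose]

end

/-! ### Circuits acting on the first qubits of a longer list -/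

section Embed

variable {N a r : ℕ} (h : N = a + r)

theorem forall_ne_iff (i : Fin a) (hi : (i : ℕ) < N) (x y : Bits N) :
    (∀ j, j ≠ ⟨i, hi⟩ → y j = x j) ↔
      (∀ j, j ≠ i → leftBits h y j = leftBits h x j) ∧ rightBits h y = rightBits h x := by
  constructor
  · intro H
    refine ⟨fun j hj => H _ ?_, funext fun j => H _ ?_⟩
    · simpa [Fin.ext_iff] using hj
    · have := i.2
      simp only [ne_eq, Fin.ext_iff]
      omega
  · rintro ⟨H₁, H₂⟩ j hj
    by_cases hja : (j : ℕ) < a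
    · exact H₁ ⟨j, hja⟩ (by simpa [Fin.ext_iff] using hj)
    · have := congrFun H₂ ⟨j - a, by omega⟩
      simp only [rightBits] at this
      have e : (⟨a + (j - a), by omega⟩ : Fin N) = j := by ext; simp; omega
      rwa [e] at this

theorem hadamardMatrix_eq_tens (i : Fin a) (hi : (i : ℕ) < N) :
    hadamardMatrix ⟨i, hi⟩ = tens h (hadamardMatrix i) 1 := by
  ext y x
  simp only [hadamardMatrix, tens, Matrix.of_apply, forall_ne_iff h, Matrix.one_apply, mul_ite,
    mul_one, mul_zero, ite_and]
  by_cases h₂ : rightBits h y = rightBits h x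
  · simp only [h₂, if_true]; rfl
  · simp [h₂]

theorem phaseMatrix_eq_tens (i : Fin a) (hi : (i : ℕ) < N) :
    phaseMatrix ⟨i, hi⟩ = tens h (phaseMatrix i) 1 := by
  ext y x
  simp only [phaseMatrix, tens, Matrix.diagonal_apply, Matrix.one_apply]
  by_cases hxy : y = x
  · subst hxy; simp [leftBits]; rfl
  · rw [if_neg hxy]
    by_cases h₁ : leftBits h y = leftBits h x
    · rw [if_neg fun h₂ => hxy (ext_bits h h₁ h₂), mul_zero]
    · rw [if_neg h₁, zero_mul]

theorem basisMap_eq_tens {f : Bits a → Bits a} {f' : Bits N → Bits N}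
    (h₁ : ∀ x, leftBits h (f' x) = f (leftBits h x))
    (h₂ : ∀ x, rightBits h (f' x) = rightBits h x) :
    basisMap f' = tens h (basisMap f) 1 := by
  ext y x
  have : y = f' x ↔ leftBits h y = f (leftBits h x) ∧ rightBits h y = rightBits h x := by
    rw [← h₁, ← h₂ x]
    exact ⟨fun e => by rw [e]; exact ⟨rfl, rfl⟩, fun e => ext_bits h e.1 e.2⟩
  simp only [basisMap, tens, Matrix.of_apply, this, Matrix.one_apply, ite_and, mul_ite, mul_one,
    mul_zero]
  split_ifs <;> rfl

theorem leftBits_update (x : Bits N) (t : Fin a) (ht : (t : ℕ) < N) (b : Bool) :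
    leftBits h (Function.update x ⟨t, ht⟩ b) = Function.update (leftBits h x) t b := by
  funext j
  by_cases hj : j = t
  · subst hj; simp [leftBits]
  · have : (⟨j, by omega⟩ : Fin N) ≠ ⟨t, ht⟩ := by simpa [Fin.ext_iff] using hj
    simp [leftBits, hj, this]

theorem rightBits_update (x : Bits N) (t : Fin a) (ht : (t : ℕ) < N) (b : Bool) :
    rightBits h (Function.update x ⟨t, ht⟩ b) = rightBits h x := by
  funext j
  have : (⟨a + j, by omega⟩ : Fin N) ≠ ⟨t, ht⟩ := by
    have := t.2
    simp only [ne_eq, Fin.ext_iff]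
    omega
  simp [rightBits, this]

end Embed

theorem insertNth_apply_eq {n : ℕ} (i : Fin (n + 1)) (b : Bool) (x : Bits n) (j : Fin (n + 1)) :
    (i.insertNth b x : Bits (n + 1)) j =
      if h₁ : (j : ℕ) < i then x ⟨j, by omega⟩ else if h₂ : (j : ℕ) = i then b
        else x ⟨j - 1, by omega⟩ := by
  rcases Fin.eq_self_or_eq_succAbove i j with rfl | ⟨k, rfl⟩
  · simp
  · rw [Fin.insertNth_apply_succAbove]
    by_cases hk : (k : ℕ) < i
    · have e : ((i.succAbove k : Fin (n + 1)) : ℕ) = k := by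
        rw [Fin.succAbove_of_castSucc_lt _ _ hk]; rfl
      simp [e, hk]
    · have e : ((i.succAbove k : Fin (n + 1)) : ℕ) = k + 1 := by
        rw [Fin.succAbove_of_le_castSucc _ _ (by simpa [Fin.le_def] using hk)]; rfl
      rw [dif_neg (by omega), dif_neg (by omega)]
      congr 1; ext; simp [e]

theorem removeNth_apply_eq {n : ℕ} (i : Fin (n + 1)) (x : Bits (n + 1)) (j : Fin n) :
    i.removeNth x j = if (j : ℕ) < i then x j.castSucc else x j.succ := by
  rw [Fin.removeNth, Fin.succAbove]
  simp only [Fin.lt_def, Fin.val_castSucc]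
  split_ifs <;> rfl

/-- The matrix of an embedded unitary gate is the old one tensored with the identity. Inserting or
removing a qubit among the first ones merely shifts the last `r` positions. -/
theorem Gate.toMap_embed (r : ℕ) {a b : ℕ} (g : Gate a b) (ha : r + a = a + r)
    (hb : r + b = b + r) (X : Op a) (Y : Op r) :
    (g.embed r).toMap (tens ha X Y) = tens hb (g.toMap X) Y := by
  cases g with
  | hadamard i =>
    simp only [Gate.embed, Gate.toMap]
    rw [hadamardMatrix_eq_tens ha, conjBy_tens]
  | phase i =>
    simp only [Gate.embed, Gate.toMap]
    rw [phaseMatrix_eq_tens ha, conjBy_tens]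
  | cnot c t h =>
    simp only [Gate.embed, Gate.toMap]
    rw [basisMap_eq_tens ha (f := fun x => Function.update x t (xor (x t) (x c))), conjBy_tens]
    · intro x
      rw [leftBits_update]; rfl
    · intro x
      rw [rightBits_update]
  | toffoli c₁ c₂ t h₁₂ h₁ h₂ =>
    simp only [Gate.embed, Gate.toMap]
    rw [basisMap_eq_tens ha (f := fun x => Function.update x t (xor (x t) (x c₁ && x c₂))),
      conjBy_tens]
    · intro x
      rw [leftBits_update]; rfl
    · intro x
      rw [rightBits_update]
  | aux i =>
    ext x y
    have hi := i.2
    have e₁ : ∀ x : Bits (r + a + 1), leftBits ha (Fin.removeNth ⟨i, by omega⟩ x) =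
        i.removeNth (leftBits (show r + a + 1 = a + 1 + r by omega) x) := by
      intro x; funext j
      simp only [leftBits, removeNth_apply_eq]; rfl
    have e₂ : ∀ x : Bits (r + a + 1), rightBits ha (Fin.removeNth ⟨i, by omega⟩ x) =
        rightBits (show r + a + 1 = a + 1 + r by omega) x := by
      intro x; funext j
      simp only [rightBits, removeNth_apply_eq]
      rw [if_neg (by omega)]
      congr 1; ext; simp; omega
    simp only [Gate.embed, Gate.toMap, LinearMap.coe_mk, AddHom.coe_mk, Matrix.of_apply, tens,
      e₁, e₂, ite_mul, zero_mul]
    rfl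
  | discard i =>
    ext x y
    have hi := i.2
    have e₁ : ∀ c (x : Bits (r + b)), leftBits ha
        (Fin.insertNth (α := fun _ => Bool) (⟨i, by omega⟩ : Fin (r + b + 1)) c x) =
        i.insertNth c (leftBits hb x) := by
      intro c x; funext j
      simp only [leftBits, insertNth_apply_eq]
    have e₂ : ∀ c (x : Bits (r + b)), rightBits ha
        (Fin.insertNth (α := fun _ => Bool) (⟨i, by omega⟩ : Fin (r + b + 1)) c x) =
        rightBits hb x := by
      intro c x; funext j
      simp only [rightBits, insertNth_apply_eq]
      rw [dif_neg (by omega), dif_neg (by omega)]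
      congr 1; ext; simp only; omega
    simp only [Gate.embed, Gate.toMap, LinearMap.coe_mk, AddHom.coe_mk, Matrix.of_apply, tens,
      Finset.sum_mul]
    refine Finset.sum_congr rfl fun c _ => ?_
    exact congrArg₂ _ (congrArg₂ X (e₁ c x) (e₁ c y)) (congrArg₂ Y (e₂ c x) (e₂ c y))

theorem Circuit.toMap_embed (r : ℕ) {a b : ℕ} (C : Circuit a b) (ha : r + a = a + r)
    (hb : r + b = b + r) (X : Op a) (Y : Op r) :
    (C.embed r).toMap (tens ha X Y) = tens hb (C.toMap X) Y := by
  induction C with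
  | nil => rfl
  | cons g C ih =>
    simp only [Circuit.embed, Circuit.toMap, LinearMap.comp_apply]
    rw [Gate.toMap_embed r g ha (by omega), ih]

theorem Circuit.toMap_cast_tens {a b a' b' r : ℕ} (h₁ : r + a = a') (h₂ : r + b = b')
    (ha : a' = a + r) (hb : b' = b + r) (C : Circuit a b) (X : Op a) (Y : Op r) :
    ((C.embed r).cast h₁ h₂).toMap (tens ha X Y) = tens hb (C.toMap X) Y := by
  subst h₁ h₂
  exact Circuit.toMap_embed r C ha hb X Y

/-! ### The action of classical reversible gates -/

/-- CNOT and Toffoli are their own inverses, so conjugation by them only permutes matrix entries. -/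
theorem conjBy_basisMap_apply {N : ℕ} {f : Bits N → Bits N} (hf : Function.Involutive f)
    (ρ : Op N) (u v : Bits N) : conjBy (basisMap f) ρ u v = ρ (f u) (f v) := by
  have e : ∀ u x, u = f x ↔ x = f u := fun u x => ⟨fun h => by rw [h, hf], fun h => by rw [h, hf]⟩
  simp [conjBy, Matrix.mul_apply, basisMap, e u, e v]

theorem involutive_update_xor {N : ℕ} (t : Fin N) (g : Bits N → Bool)
    (hg : ∀ x b, g (Function.update x t b) = g x) :
    Function.Involutive fun x : Bits N => Function.update x t (xor (x t) (g x)) := by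
  intro x
  simp [hg]

/-! ### Moving a block of qubits to the end of the list -/

/-- Move the qubit at position `p` to the end of the list, and dephase it. -/
def moveStep {N p : ℕ} (hp : p < N) : Circuit N N :=
  .cons (.aux (Fin.last N)) <|
  .cons (.cnot ⟨p, by omega⟩ (Fin.last N) (by simp [Fin.ext_iff]; omega)) <|
  .cons (.discard ⟨p, by omega⟩) (.nil N)

/-- Move the `t` qubits starting at position `p` to the end of the list, and dephase them. -/
def moveBlock {N p : ℕ} (hp : p < N) (t : ℕ) : Circuit N N := (moveStep hp).repeat t

/-- The bit string with the last `t` bits moved to position `p`. -/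
def unmove {N : ℕ} (p t : ℕ) (u : Bits N) : Bits N := fun j =>
  if h₁ : (j : ℕ) < p then u j else
    if h₂ : (j : ℕ) < p + t then u ⟨N - t + (j - p), by omega⟩ else u ⟨j - t, by omega⟩

theorem toMap_moveStep_apply {N p : ℕ} (hp : p < N) (ρ : Op N) (u v : Bits N) :
    (moveStep hp).toMap ρ u v =
      if u ⟨N - 1, by omega⟩ = v ⟨N - 1, by omega⟩ then ρ (unmove p 1 u) (unmove p 1 v) else 0 := by
  have hinv := involutive_update_xor (Fin.last N) (fun x : Bits (N + 1) => x ⟨p, by omega⟩)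
    (fun x b => by rw [Function.update_of_ne]; simp [Fin.ext_iff]; omega)
  have h₁ : ∀ b (u : Bits N), (Fin.insertNth (α := fun _ => Bool) (⟨p, by omega⟩ : Fin (N + 1)) b u)
      (Fin.last N) = u ⟨N - 1, by omega⟩ := by
    intro b u
    rw [insertNth_apply_eq]
    simp only [Fin.val_last]
    rw [dif_neg (by omega), dif_neg (by omega)]
  have h₂ : ∀ b (u : Bits N), (Fin.insertNth (α := fun _ => Bool) (⟨p, by omega⟩ : Fin (N + 1)) b u)
      ⟨p, by omega⟩ = b := by
    intro b u
    simp
  have h₃ : ∀ (u : Bits N) (c : Bool), u ⟨N - 1, by omega⟩ = c →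
      Fin.init (Fin.insertNth (α := fun _ => Bool) (⟨p, by omega⟩ : Fin (N + 1)) c u) =
        unmove p 1 u := by
    rintro u _ rfl
    funext j
    rw [Fin.init, insertNth_apply_eq, unmove]
    simp only [Fin.val_castSucc]
    split_ifs with h h' h₄ h₅
    · rfl
    · congr 1; ext; simp only; omega
    · omega
    · omega
    · rfl
  simp only [moveStep, Circuit.toMap, Gate.toMap, LinearMap.comp_apply, LinearMap.id_apply,
    LinearMap.coe_mk, AddHom.coe_mk, Matrix.of_apply]
  rw [Finset.sum_congr rfl fun b _ => conjBy_basisMap_apply hinv _ _ _]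
  simp only [Matrix.of_apply, Function.update_self, h₁, h₂]
  -- The appended qubit started in state 0, so undoing the CNOT must leave 0 there. This forces the
  -- traced-out bit to equal the last bit of both `u` and `v`, and removes every term in which those
  -- differ.
  cases hu : u ⟨N - 1, by omega⟩ <;> cases hv : v ⟨N - 1, by omega⟩ <;>
    simp only [Fintype.sum_bool] <;> simp
  · exact congrArg₂ ρ (h₃ u _ hu) (h₃ v _ hv)
  · exact congrArg₂ ρ (h₃ u _ hu) (h₃ v _ hv)

/-- After each move the next qubit of the block sits at position `p`, so the same step is repeated
and the block arrives at the end in its original order. -/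
theorem toMap_moveBlock_apply {N p : ℕ} (hp : p < N) (t : ℕ) (ht : p + t ≤ N) (ρ : Op N)
    (u v : Bits N) :
    (moveBlock hp t).toMap ρ u v =
      if ∀ j : Fin N, N - t ≤ j → u j = v j then ρ (unmove p t u) (unmove p t v) else 0 := by
  induction t generalizing ρ with
  | zero =>
    have e : ∀ u : Bits N, unmove p 0 u = u := by
      intro u; funext j
      simp only [unmove]
      split_ifs <;> first | rfl | omega
    rw [if_pos (fun j hj => by omega), e, e]; rfl
  | succ t ih =>
    have e : ∀ u : Bits N, unmove p 1 (unmove p t u) = unmove p (t + 1) u := by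
      intro u; funext j
      simp only [unmove]
      split_ifs <;> first
        | rfl
        | omega
        | (congr 1; ext; simp only; omega)
    have hlast : ∀ u : Bits N, unmove p t u ⟨N - 1, by omega⟩ = u ⟨N - (t + 1), by omega⟩ := by
      intro u
      simp only [unmove]
      rw [dif_neg (by omega), dif_neg (by omega)]
      congr 1; ext; simp only; omega
    have hc : (∀ j : Fin N, N - (t + 1) ≤ j → u j = v j) ↔
        (∀ j : Fin N, N - t ≤ j → u j = v j) ∧
          u ⟨N - (t + 1), by omega⟩ = v ⟨N - (t + 1), by omega⟩ := by
      constructor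
      · exact fun H => ⟨fun j hj => H j (by omega), H _ (by simp)⟩
      · rintro ⟨H₁, H₂⟩ j hj
        by_cases hj' : N - t ≤ j
        · exact H₁ j hj'
        · have : j = ⟨N - (t + 1), by omega⟩ := by ext; simp only; omega
          rw [this]; exact H₂
    have hm : (moveBlock hp (t + 1)).toMap ρ = (moveBlock hp t).toMap ((moveStep hp).toMap ρ) := by
      simp only [moveBlock, Circuit.repeat, Circuit.toMap_append]
    rw [hm, ih (by omega), toMap_moveStep_apply, e, e, hlast, hlast, ← ite_and]
    simp only [hc]

/-- The block of an operator that belongs to the basis state `q` of the last qubits. -/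
def sliceOp {P p n : ℕ} (h : P = p + n) (q : Bits n) (σ : Op P) : Op p := fun x y =>
  σ (joinBits h x q) (joinBits h y q)

/-- Dephasing the moved block is measuring it: only the diagonal blocks of `σ` survive, each
labelled by its outcome `q`. -/
theorem toMap_moveBlock_tens {N P M p n r : ℕ} (hp : p < N) (h₁ : N = P + r) (h₂ : P = p + n)
    (h₃ : N = M + n) (h₄ : M = p + r) (σ : Op P) (R : Op r) :
    (moveBlock hp n).toMap (tens h₁ σ R) =
      ∑ q : Bits n, tens h₃ (tens h₄ (sliceOp h₂ q σ) R) (ketbra q) := by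
  ext u v
  have hc : (∀ j : Fin N, N - n ≤ j → u j = v j) ↔ rightBits h₃ u = rightBits h₃ v := by
    constructor
    · exact fun H => funext fun j => H _ (by simp only; omega)
    · intro H j hj
      have := congrFun H ⟨j - M, by omega⟩
      simp only [rightBits] at this
      have e : (⟨M + (j - M), by omega⟩ : Fin N) = j := by ext; simp only; omega
      rwa [e] at this
  have e₁ : ∀ u : Bits N, leftBits h₁ (unmove p n u) =
      joinBits h₂ (leftBits h₄ (leftBits h₃ u)) (rightBits h₃ u) := by
    intro u; funext j
    simp only [leftBits, rightBits, joinBits, unmove]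
    split_ifs
    · rfl
    · congr 1; ext; simp only; omega
    · omega
  have e₂ : ∀ u : Bits N, rightBits h₁ (unmove p n u) = rightBits h₄ (leftBits h₃ u) := by
    intro u; funext j
    simp only [leftBits, rightBits, unmove]
    rw [dif_neg (by omega), dif_neg (by omega)]
    congr 1; ext; simp only; omega
  rw [toMap_moveBlock_apply hp n (by omega)]
  simp only [hc, Matrix.sum_apply, tens, e₁, e₂, sliceOp, ketbra, Matrix.single_apply, mul_ite,
    mul_one, mul_zero]
  by_cases h : rightBits h₃ u = rightBits h₃ v
  · simp [h]
  · rw [if_neg h, Finset.sum_eq_zero]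
    intro q _
    rw [if_neg]
    rintro ⟨rfl, h'⟩
    exact h h'

/-! ### Copying the last qubits to the front of the list -/

/-- Copy the last `t` of `N` qubits to the front of the list. -/
def copyFront {N : ℕ} (hN : 0 < N) : (t : ℕ) → Circuit N (N + t)
  | 0 => .nil N
  | t + 1 => (copyFront hN t).append <| .cons (.aux 0) <|
      .cons (.cnot ⟨N, by omega⟩ ⟨0, by omega⟩ (by simp [Fin.ext_iff]; omega)) (.nil (N + t + 1))

/-- Every new front qubit shifts the others by one, so the fixed control position `N` walks
backwards through the last block, and the copies end up in the right order. -/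
theorem toMap_copyFront_apply {N : ℕ} (hN : 0 < N) (t : ℕ) (ht : t ≤ N) (ρ : Op N)
    (u v : Bits (N + t)) :
    (copyFront hN t).toMap ρ u v =
      if (∀ j : Fin t, u ⟨j, by omega⟩ = u ⟨N + j, by omega⟩) ∧
          (∀ j : Fin t, v ⟨j, by omega⟩ = v ⟨N + j, by omega⟩) then
        ρ (fun j => u ⟨j + t, by omega⟩) (fun j => v ⟨j + t, by omega⟩) else 0 := by
  induction t with
  | zero => simp [copyFront, Circuit.toMap]
  | succ t ih =>
    have hinv := involutive_update_xor (⟨0, by omega⟩ : Fin (N + t + 1))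
      (fun x : Bits (N + t + 1) => x ⟨N, by omega⟩)
      (fun x b => by rw [Function.update_of_ne]; simp [Fin.ext_iff]; omega)
    have h₁ : ∀ (u : Bits (N + t + 1)) c, Fin.removeNth 0 (Function.update u
        (⟨0, by omega⟩ : Fin (N + t + 1)) c) = fun j => u j.succ := by
      intro u c; funext j
      rw [removeNth_apply_eq, if_neg (by simp), Function.update_of_ne (by simp [Fin.ext_iff])]
    have hc : ∀ u : Bits (N + t + 1),
        (∀ j : Fin (t + 1), u ⟨j, by omega⟩ = u ⟨N + j, by omega⟩) ↔
          xor (u ⟨0, by omega⟩) (u ⟨N, by omega⟩) = false ∧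
            ∀ j : Fin t, u ⟨j + 1, by omega⟩ = u ⟨N + j + 1, by omega⟩ := by
      intro u
      rw [Fin.forall_fin_succ]
      refine and_congr (by simp) (forall_congr' fun j => Iff.rfl)
    simp only [copyFront, Circuit.toMap_append]
    simp only [Circuit.toMap, LinearMap.comp_apply, Gate.toMap, LinearMap.id_apply]
    rw [conjBy_basisMap_apply hinv]
    simp only [LinearMap.coe_mk, AddHom.coe_mk, Matrix.of_apply]
    rw [ih (by omega)]
    have hz : (0 : Fin (N + t + 1)) = ⟨0, by omega⟩ := rfl
    have hcu := hc u
    have hcv := hc v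
    simp only [h₁]
    simp only [hz, Function.update_self]
    rw [← ite_and]
    refine if_congr ?_ ?_ rfl
    · rw [hcu, hcv]
      constructor
      · rintro ⟨⟨a, b⟩, c, d⟩; exact ⟨⟨a, c⟩, b, d⟩
      · rintro ⟨⟨a, b⟩, c, d⟩; exact ⟨⟨a, c⟩, b, d⟩
    · rfl

theorem toMap_copyFront_tens {N M K n : ℕ} (hN : 0 < N) (h : N = M + n) (h' : N + n = n + K)
    (h'' : K = M + n) (Y : Op M) (q : Bits n) :
    (copyFront hN n).toMap (tens h Y (ketbra q)) =
      tens h' (ketbra q) (tens h'' Y (ketbra q)) := by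
  ext u v
  rw [toMap_copyFront_apply hN n (by omega)]
  have e₁ : ∀ u : Bits (N + n), leftBits h (fun j => u ⟨j + n, by omega⟩) =
      leftBits h'' (rightBits h' u) := by
    intro u; funext j
    simp only [leftBits, rightBits]
    congr 1; ext; simp only; omega
  have e₂ : ∀ u : Bits (N + n), rightBits h (fun j => u ⟨j + n, by omega⟩) =
      rightBits h'' (rightBits h' u) := by
    intro u; funext j
    simp only [rightBits]
    congr 1; ext; simp only; omega
  have hc : ∀ u : Bits (N + n), (∀ j : Fin n, u ⟨j, by omega⟩ = u ⟨N + j, by omega⟩) ↔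
      rightBits h'' (rightBits h' u) = leftBits h' u := by
    intro u
    rw [eq_comm, funext_iff]
    refine forall_congr' fun j => ?_
    simp only [leftBits, rightBits]
    have : (⟨N + j, by omega⟩ : Fin (N + n)) = ⟨n + (M + j), by omega⟩ := by
      ext; simp only; omega
    rw [this]
  simp only [hc, tens, e₁, e₂, ketbra, Matrix.single_apply]
  by_cases hu : q = rightBits h'' (rightBits h' u)
  · by_cases hv : q = rightBits h'' (rightBits h' v)
    · rw [← hu, ← hv]
      split_ifs <;> simp
    · simp [hv]
  · simp [hu]

/-! ### Expansion in matrix units -/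

theorem op_eq_sum {N : ℕ} (X : Op N) :
    X = ∑ p, ∑ p', X p p' • (Matrix.single p p' 1 : Op N) := by
  conv_lhs => rw [Matrix.matrix_eq_sum_single X]
  simp [Matrix.smul_single]

theorem superOp_apply_eq_sum {a b : ℕ} (Φ : SuperOp a b) (X : Op a) :
    Φ X = ∑ p, ∑ p', X p p' • Φ (Matrix.single p p' 1) := by
  conv_lhs => rw [op_eq_sum X]
  simp only [map_sum, map_smul]

theorem superOp_ext {a b : ℕ} {Φ Ψ : SuperOp a b}
    (h : ∀ p p', Φ (Matrix.single p p' 1) = Ψ (Matrix.single p p' 1)) : Φ = Ψ := by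
  ext1 X
  rw [superOp_apply_eq_sum Φ, superOp_apply_eq_sum Ψ]
  simp only [h]

theorem tens_sum_left {ι : Type*} {N a r : ℕ} (h : N = a + r) (s : Finset ι) (X : ι → Op a)
    (Y : Op r) : tens h (∑ i ∈ s, X i) Y = ∑ i ∈ s, tens h (X i) Y := by
  ext x y; simp [tens, Matrix.sum_apply, Finset.sum_mul]

theorem tens_sum_right {ι : Type*} {N a r : ℕ} (h : N = a + r) (s : Finset ι) (X : Op a)
    (Y : ι → Op r) : tens h X (∑ i ∈ s, Y i) = ∑ i ∈ s, tens h X (Y i) := by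
  ext x y; simp [tens, Matrix.sum_apply, Finset.mul_sum]

theorem tens_smul_left {N a r : ℕ} (h : N = a + r) (c : ℂ) (X : Op a) (Y : Op r) :
    tens h (c • X) Y = c • tens h X Y := by
  ext x y; simp [tens, mul_assoc]

theorem tens_smul_right {N a r : ℕ} (h : N = a + r) (c : ℂ) (X : Op a) (Y : Op r) :
    tens h X (c • Y) = c • tens h X Y := by
  ext x y; simp [tens]; ring

theorem tensorMap_apply {a b c d : ℕ} (Φ : SuperOp a c) (Ψ : SuperOp b d) (ρ : Op (a + b)) :
    tensorMap Φ Ψ ρ = ∑ p, ∑ p', ∑ q, ∑ q', ρ (joinBits rfl p q) (joinBits rfl p' q') •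
      tens rfl (Φ (Matrix.single p p' 1)) (Ψ (Matrix.single q q' 1)) := by
  simp only [joinBits_eq_append, ← tensorOp_eq_tens]
  rfl

theorem tens_joinBits {N a r : ℕ} (h : N = a + r) (X : Op a) (Y : Op r) (x x' : Bits a)
    (y y' : Bits r) : tens h X Y (joinBits h x y) (joinBits h x' y') = X x x' * Y y y' := by
  simp [tens]

/-- Both sides are bilinear in `X` and `Y`. Product operators suffice below, since all other
operators are expanded in matrix units. -/
theorem tensorMap_tens {a b c d : ℕ} (Φ : SuperOp a c) (Ψ : SuperOp b d) (X : Op a) (Y : Op b) :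
    tensorMap Φ Ψ (tens rfl X Y) = tens rfl (Φ X) (Ψ Y) := by
  rw [tensorMap_apply, superOp_apply_eq_sum Φ X, superOp_apply_eq_sum Ψ Y]
  simp only [tens_sum_left, tens_smul_left, tens_joinBits]
  simp only [tens_sum_right, tens_smul_right, Finset.smul_sum, mul_smul]

/-! ### The conjunction of a bit with the bits of a string -/

/-- Append the conjunction of the qubits `0` and `1` to the list, then trace out the qubit `1`. -/
def andStep {N : ℕ} (hN : 1 < N) : Circuit N N :=
  .cons (.aux (Fin.last N)) <|
  .cons (.toffoli ⟨0, by omega⟩ ⟨1, by omega⟩ (Fin.last N) (by simp)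
    (by simp [Fin.ext_iff]; omega) (by simp [Fin.ext_iff]; omega)) <|
  .cons (.discard ⟨1, by omega⟩) (.nil N)

/-- The map `(b, q) ↦ b ∧ q`. -/
def andBlock {n : ℕ} (hn : 0 < n) : Circuit (n + 1) n :=
  ((andStep (show 1 < n + 1 by omega)).repeat n).append (.cons (.discard 0) (.nil n))

theorem toMap_aux_single {n : ℕ} (i : Fin (n + 1)) (x y : Bits n) :
    (Gate.aux i).toMap (Matrix.single x y 1) =
      Matrix.single (i.insertNth false x : Bits (n + 1)) (i.insertNth false y : Bits (n + 1)) 1 := by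
  ext u v
  simp only [Gate.toMap, LinearMap.coe_mk, AddHom.coe_mk, Matrix.of_apply, Matrix.single_apply,
    Fin.insertNth_eq_iff]
  cases u i <;> cases v i <;> simp

theorem toMap_discard_single {n : ℕ} (i : Fin (n + 1)) (x y : Bits (n + 1)) :
    (Gate.discard i).toMap (Matrix.single x y 1) =
      if x i = y i then Matrix.single (i.removeNth x : Bits n) (i.removeNth y : Bits n) 1
      else 0 := by
  ext u v
  simp only [Gate.toMap, LinearMap.coe_mk, AddHom.coe_mk, Matrix.of_apply, Matrix.single_apply,
    Fin.eq_insertNth_iff]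
  cases hx : x i <;> cases hy : y i <;> rw [Fintype.sum_bool] <;> simp [Matrix.single_apply]

theorem conjBy_basisMap_single {N : ℕ} {f : Bits N → Bits N} (hf : Function.Involutive f)
    (x y : Bits N) :
    conjBy (basisMap f) (Matrix.single x y 1) = Matrix.single (f x) (f y) 1 := by
  ext u v
  rw [conjBy_basisMap_apply hf]
  simp only [Matrix.single_apply, hf.eq_iff]

/-- The effect of `t` repetitions of `andStep` on bit strings. -/
def andMove {N t : ℕ} (ht : t < N) (x : Bits N) : Bits N := fun j =>
  if (j : ℕ) = 0 then x ⟨0, by omega⟩ else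
    if h : (j : ℕ) + t < N then x ⟨j + t, h⟩ else
      x ⟨0, by omega⟩ && x ⟨j + t + 1 - N, by omega⟩

theorem toMap_andStep_single {N : ℕ} (hN : 1 < N) (x y : Bits N) :
    (andStep hN).toMap (Matrix.single x y 1) =
      if x ⟨1, hN⟩ = y ⟨1, hN⟩ then Matrix.single (andMove hN x) (andMove hN y) 1 else 0 := by
  have hinv := involutive_update_xor (Fin.last N)
    (fun x : Bits (N + 1) => x ⟨0, by omega⟩ && x ⟨1, by omega⟩)
    (fun x b => by
      rw [Function.update_of_ne, Function.update_of_ne] <;> simp [Fin.ext_iff] <;> omega)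
  simp only [andStep, Circuit.toMap, LinearMap.comp_apply, LinearMap.id_apply, toMap_aux_single]
  rw [show ∀ ρ, (Gate.toMap (.toffoli (n := N + 1) ⟨0, by omega⟩ ⟨1, by omega⟩ (Fin.last N)
    (by simp) (by simp [Fin.ext_iff]; omega) (by simp [Fin.ext_iff]; omega))) ρ =
    conjBy (basisMap _) ρ from fun _ => rfl, conjBy_basisMap_single hinv, toMap_discard_single]
  have e : ∀ (x : Bits N) (j : ℕ) (hj : j < N),
      (Fin.insertNth (α := fun _ => Bool) (Fin.last N) false x) ⟨j, by omega⟩ = x ⟨j, hj⟩ := by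
    intro x j hj
    rw [insertNth_apply_eq, dif_pos (by simpa using hj)]
  have e₁ : ∀ (x : Bits N) c, Function.update
      (Fin.insertNth (α := fun _ => Bool) (Fin.last N) false x) (Fin.last N) c ⟨1, by omega⟩ =
      x ⟨1, hN⟩ := by
    intro x c
    rw [Function.update_of_ne (by simp [Fin.ext_iff]; omega), e x 1 hN]
  have e₂ : ∀ x : Bits N, Fin.removeNth (⟨1, by omega⟩ : Fin (N + 1)) (Function.update
      (Fin.insertNth (α := fun _ => Bool) (Fin.last N) false x) (Fin.last N)
        (xor ((Fin.insertNth (α := fun _ => Bool) (Fin.last N) false x) (Fin.last N))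
        ((Fin.insertNth (α := fun _ => Bool) (Fin.last N) false x) ⟨0, by omega⟩ &&
          (Fin.insertNth (α := fun _ => Bool) (Fin.last N) false x) ⟨1, by omega⟩))) =
      andMove hN x := by
    intro x; funext j
    rw [removeNth_apply_eq, Fin.insertNth_apply_same, e x 0 (by omega), e x 1 hN, andMove]
    by_cases h₀ : (j : ℕ) = 0
    · rw [if_pos (by simp only; omega), if_pos h₀, Function.update_of_ne (Fin.castSucc_ne_last j)]
      have : j.castSucc = (⟨0, by omega⟩ : Fin (N + 1)) := by ext; simpa using h₀
      rw [this, e x 0 (by omega)]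
    · rw [if_neg (by simp only; omega), if_neg h₀]
      by_cases h₁ : (j : ℕ) + 1 < N
      · rw [dif_pos h₁, Function.update_of_ne (by simp [Fin.ext_iff]; omega)]
        exact e x (j + 1) h₁
      · have : j.succ = Fin.last N := by ext; simp; omega
        rw [dif_neg h₁, this, Function.update_self]
        simp only [Bool.false_xor]
        congr 2; ext; simp only; omega
  rw [e₁, e₁, e₂, e₂]

/-- Each step takes the bit at position 1 and puts its conjunction with bit 0 at the end, so the
string rotates past the control bit. Tracing out the old bit forces it to agree in `x` and `y`. -/
theorem toMap_repeat_andStep_single {N : ℕ} (hN : 1 < N) (t : ℕ) (ht : t < N) (x y : Bits N) :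
    ((andStep hN).repeat t).toMap (Matrix.single x y 1) =
      if ∀ j : Fin N, 1 ≤ (j : ℕ) → (j : ℕ) ≤ t → x j = y j then
        Matrix.single (andMove ht x) (andMove ht y) 1 else 0 := by
  induction t generalizing x y with
  | zero =>
    have e : ∀ x : Bits N, andMove ht x = x := by
      intro x; funext j
      simp only [andMove]
      split_ifs with h₁ h₂
      · congr 1; ext; simp [h₁]
      · rfl
      · omega
    rw [if_pos (fun j _ _ => by omega), e, e]; rfl
  | succ t ih =>
    have e : ∀ x : Bits N, andMove (show t < N by omega) (andMove hN x) = andMove ht x := by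
      intro x; funext j
      simp only [andMove]
      split_ifs <;> first
        | rfl
        | omega
        | (congr 2; ext; simp only; omega)
    have hc : (∀ j : Fin N, 1 ≤ (j : ℕ) → (j : ℕ) ≤ t + 1 → x j = y j) ↔
        x ⟨1, hN⟩ = y ⟨1, hN⟩ ∧
          ∀ j : Fin N, 1 ≤ (j : ℕ) → (j : ℕ) ≤ t → andMove hN x j = andMove hN y j := by
      have e' : ∀ (x : Bits N) (j : Fin N) (h₁ : 1 ≤ (j : ℕ)) (h₂ : (j : ℕ) ≤ t),
          andMove hN x j = x ⟨j + 1, by omega⟩ := by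
        intro x j h₁ h₂
        simp only [andMove]
        rw [if_neg (by omega), dif_pos (by omega)]
      constructor
      · intro H
        refine ⟨H _ le_rfl (by simp), fun j h₁ h₂ => ?_⟩
        rw [e' x j h₁ h₂, e' y j h₁ h₂]
        exact H _ (by simp) (by simpa using h₂)
      · rintro ⟨H₁, H₂⟩ j h₁ h₂
        by_cases hj : (j : ℕ) = 1
        · have : j = ⟨1, hN⟩ := Fin.ext hj
          rw [this]; exact H₁
        · have := H₂ ⟨j - 1, by omega⟩ (by simp only; omega) (by simp only; omega)
          rw [e' _ _ (by simp only; omega) (by simp only; omega),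
            e' _ _ (by simp only; omega) (by simp only; omega)] at this
          have e'' : (⟨j - 1 + 1, by omega⟩ : Fin N) = j := by ext; simp only; omega
          simpa only [e''] using this
    rw [Circuit.repeat, Circuit.toMap_append, toMap_andStep_single]
    by_cases h : x ⟨1, hN⟩ = y ⟨1, hN⟩
    · rw [if_pos h, ih (by omega), e, e]
      simp only [hc, h, true_and]
    · rw [if_neg h, map_zero, if_neg fun H => h (hc.1 H).1]

theorem toMap_andBlock_single {n : ℕ} (hn : 0 < n) (x y : Bits (n + 1)) :
    (andBlock hn).toMap (Matrix.single x y 1) =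
      if x = y then Matrix.single (fun j => x 0 && x j.succ) (fun j => y 0 && y j.succ) 1
      else 0 := by
  have e : ∀ x : Bits (n + 1), Fin.removeNth 0 (andMove (show n < n + 1 by omega) x) =
      fun j => x 0 && x j.succ := by
    intro x; funext j
    rw [removeNth_apply_eq, if_neg (by simp)]
    simp only [andMove, Fin.val_succ]
    rw [if_neg (by omega), dif_neg (by omega)]
    congr 2; ext; simp only [Fin.val_succ]; omega
  rw [andBlock, Circuit.toMap_append, toMap_repeat_andStep_single _ n (by omega)]
  by_cases h : x = y
  · subst h
    simp only [implies_true, if_true, Circuit.toMap, LinearMap.comp_apply, LinearMap.id_apply]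
    rw [toMap_discard_single, if_pos rfl, e]
  · rw [if_neg h]
    split_ifs with H
    · simp only [Circuit.toMap, LinearMap.comp_apply, LinearMap.id_apply]
      rw [toMap_discard_single, if_neg]
      intro h₀
      apply h
      funext j
      by_cases hj : (j : ℕ) = 0
      · have : j = 0 := Fin.ext hj
        rw [this]; exact h₀
      · exact H j (by omega) (by omega)
    · simp

theorem toMap_andBlock_tens {n : ℕ} (hn : 0 < n) (h : n + 1 = 1 + n) (Y : Op 1) (q : Bits n) :
    (andBlock hn).toMap (tens h Y (ketbra q)) =
      ∑ b : Bits 1, Y b b • ketbra (fun j => b 0 && q j) := by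
  conv_lhs => rw [op_eq_sum Y]
  simp only [tens_sum_left, tens_smul_left, ketbra, tens_single, map_sum, map_smul,
    toMap_andBlock_single]
  refine Finset.sum_congr rfl fun b _ => ?_
  rw [Finset.sum_eq_single b]
  · have e₀ : joinBits h b q 0 = b 0 := by simp [joinBits]
    have e₁ : ∀ j : Fin n, joinBits h b q j.succ = q j := by
      intro j
      simp [joinBits]
    simp only [e₀, e₁, if_true]
  · intro b' _ hb
    rw [if_neg, smul_zero]
    intro H
    have := congrArg (leftBits h) H
    simp only [leftBits_joinBits] at this
    exact hb this.symm
  · simp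

/-! ### Kraus decompositions and positivity -/

/-- A map with a Kraus decomposition. -/
def IsKraus {a b : ℕ} (Φ : SuperOp a b) : Prop :=
  ∃ (ι : Type) (_ : Fintype ι) (K : ι → Matrix (Bits b) (Bits a) ℂ),
    ∀ ρ, Φ ρ = ∑ i, K i * ρ * (K i)ᴴ

namespace IsKraus

theorem of_single {a b : ℕ} {Φ : SuperOp a b} (K : Matrix (Bits b) (Bits a) ℂ)
    (h : ∀ ρ, Φ ρ = K * ρ * Kᴴ) : IsKraus Φ :=
  ⟨Unit, inferInstance, fun _ => K, fun ρ => by simp [h]⟩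

theorem id (a : ℕ) : IsKraus (LinearMap.id : SuperOp a a) := of_single 1 fun ρ => by simp

theorem comp {a b c : ℕ} {Ψ : SuperOp b c} {Φ : SuperOp a b} (hΨ : IsKraus Ψ) (hΦ : IsKraus Φ) :
    IsKraus (Ψ ∘ₗ Φ) := by
  obtain ⟨ι, _, K, hK⟩ := hΨ
  obtain ⟨ι', _, L, hL⟩ := hΦ
  refine ⟨ι × ι', inferInstance, fun p => K p.1 * L p.2, fun ρ => ?_⟩
  rw [LinearMap.comp_apply, hK, hL, Fintype.sum_prod_type]
  simp only [Matrix.mul_sum, Matrix.sum_mul, Matrix.conjTranspose_mul, Matrix.mul_assoc]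

theorem posSemidef {a b : ℕ} {Φ : SuperOp a b} (hΦ : IsKraus Φ) {ρ : Op a} (hρ : ρ.PosSemidef) :
    (Φ ρ).PosSemidef := by
  obtain ⟨ι, _, K, hK⟩ := hΦ
  rw [hK]
  exact Matrix.posSemidef_sum _ fun i _ => hρ.mul_mul_conjTranspose_same (K i)

/-- The matrix with entries `1` at the positions `(f x, x)`. -/
def selectRows {a b : ℕ} (f : Bits b → Bits a) : Matrix (Bits b) (Bits a) ℂ :=
  Matrix.of fun u x => if x = f u then 1 else 0

theorem selectRows_conj_apply {a b : ℕ} (f : Bits b → Bits a) (ρ : Op a) (u v : Bits b) :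
    (selectRows f * ρ * (selectRows f)ᴴ) u v = ρ (f u) (f v) := by
  simp [Matrix.mul_apply, selectRows]

theorem gate {a b : ℕ} (g : Gate a b) : IsKraus g.toMap := by
  cases g with
  | hadamard i => exact of_single _ fun ρ => rfl
  | phase i => exact of_single _ fun ρ => rfl
  | cnot c t h => exact of_single _ fun ρ => rfl
  | toffoli c₁ c₂ t h₁₂ h₁ h₂ => exact of_single _ fun ρ => rfl
  | aux i =>
    refine of_single (Matrix.diagonal (fun x : Bits _ => if x i = false then (1 : ℂ) else 0) *
      selectRows fun x => i.removeNth x) fun ρ => ?_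
    ext u v
    rw [Matrix.conjTranspose_mul, Matrix.diagonal_conjTranspose, Matrix.mul_assoc,
      Matrix.mul_assoc, ← Matrix.mul_assoc ρ, ← Matrix.mul_assoc (selectRows _),
      ← Matrix.mul_assoc (selectRows _), Matrix.diagonal_mul, Matrix.mul_diagonal,
      selectRows_conj_apply]
    simp only [Gate.toMap, LinearMap.coe_mk, AddHom.coe_mk, Matrix.of_apply, Pi.star_apply]
    cases u i <;> cases v i <;> simp
  | discard i =>
    refine ⟨Bool, inferInstance, fun b => selectRows fun x => i.insertNth b x, fun ρ => ?_⟩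
    ext u v
    simp only [Gate.toMap, LinearMap.coe_mk, AddHom.coe_mk, Matrix.of_apply, Matrix.sum_apply,
      selectRows_conj_apply]

theorem circuit {a b : ℕ} (C : Circuit a b) : IsKraus C.toMap := by
  induction C with
  | nil n => exact id n
  | cons g C ih => exact ih.comp (gate g)

theorem withKey {κ a b : ℕ} {Φ : SuperOp (κ + a) b} (hΦ : IsKraus Φ) (k : Bits κ) :
    IsKraus (withKey Φ k) := by
  refine hΦ.comp (of_single
    (Matrix.of fun u x => if u = joinBits rfl k x then 1 else 0) fun ρ => ?_)
  ext u v
  have h : ∀ (u : Bits (κ + a)) x, u = joinBits rfl k x ↔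
      leftBits rfl u = k ∧ rightBits rfl u = x := fun u x => eq_joinBits_iff rfl
  change tensorOp (ketbra k) ρ u v = _
  rw [tensorOp_eq_tens]
  simp only [tens, ketbra, Matrix.single_apply, Matrix.mul_apply, Matrix.of_apply, h,
    Matrix.conjTranspose_apply]
  by_cases hu : leftBits rfl u = k <;> by_cases hv : leftBits rfl v = k <;>
    simp [hu, hv, eq_comm (a := k)]

/-- The tensor product of Kraus operators. -/
def tensRect {a b c d : ℕ} (K : Matrix (Bits c) (Bits a) ℂ) (L : Matrix (Bits d) (Bits b) ℂ) :
    Matrix (Bits (c + d)) (Bits (a + b)) ℂ := fun u x =>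
  K (leftBits rfl u) (leftBits rfl x) * L (rightBits rfl u) (rightBits rfl x)

theorem tensRect_conj {a b c d : ℕ} (K : Matrix (Bits c) (Bits a) ℂ)
    (L : Matrix (Bits d) (Bits b) ℂ) (X : Op a) (Y : Op b) :
    tensRect K L * tens rfl X Y * (tensRect K L)ᴴ = tens rfl (K * X * Kᴴ) (L * Y * Lᴴ) := by
  ext u v
  simp only [Matrix.mul_apply, tensRect, tens, sum_bits (rfl : a + b = a + b), leftBits_joinBits,
    rightBits_joinBits, Matrix.conjTranspose_apply, Finset.sum_mul_sum, star_mul']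
  refine Finset.sum_congr rfl fun x' _ => Finset.sum_congr rfl fun y' _ => ?_
  have : ∀ (A B : ℂ) (f : Bits a → ℂ) (g : Bits b → ℂ),
      (∑ x, ∑ y, f x * g y) * (A * B) = ((∑ x, f x) * A) * ((∑ y, g y) * B) := by
    intro A B f g
    rw [← Finset.sum_mul_sum]; ring
  rw [← this]
  congr 1
  refine Finset.sum_congr rfl fun x _ => Finset.sum_congr rfl fun y _ => by ring

/-- Positivity of the two maps alone would not make their tensor product positive; products of Kraus
operators do. Both sides are linear, so they are compared on matrix units, which are products. -/
theorem tensorMap {a b c d : ℕ} {Φ : SuperOp a c} {Ψ : SuperOp b d} (hΦ : IsKraus Φ)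
    (hΨ : IsKraus Ψ) : IsKraus (tensorMap Φ Ψ) := by
  obtain ⟨ι, _, K, hK⟩ := hΦ
  obtain ⟨ι', _, L, hL⟩ := hΨ
  refine ⟨ι × ι', inferInstance, fun p => tensRect (K p.1) (L p.2), ?_⟩
  let Θ : SuperOp (a + b) (c + d) :=
    { toFun := fun ρ => ∑ p : ι × ι', tensRect (K p.1) (L p.2) * ρ * (tensRect (K p.1) (L p.2))ᴴ
      map_add' := fun ρ σ => by
        simp only [Matrix.mul_add, Matrix.add_mul, Finset.sum_add_distrib]
      map_smul' := fun z ρ => by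
        simp only [Matrix.mul_smul, Matrix.smul_mul, Finset.smul_sum, RingHom.id_apply] }
  have h : UncloneableEncryption.tensorMap Φ Ψ = Θ := by
    refine superOp_ext fun p p' => ?_
    have hs : (Matrix.single p p' 1 : Op (a + b)) =
        tens rfl (Matrix.single (leftBits rfl p) (leftBits rfl p') 1)
          (Matrix.single (rightBits rfl p) (rightBits rfl p') 1) := by
      rw [tens_single, joinBits_leftBits_rightBits, joinBits_leftBits_rightBits]
    rw [hs, tensorMap_tens]
    change _ = ∑ p : ι × ι', _
    simp only [tensRect_conj, hK, hL, Fintype.sum_prod_type, tens_sum_left, tens_sum_right]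
    rw [Finset.sum_comm]
  intro ρ
  rw [h]
  rfl

end IsKraus

/-! ### Positive operators, and outcome probabilities as diagonal entries. -/

theorem ketbra_posSemidef {n : ℕ} (x : Bits n) : (ketbra x).PosSemidef := by
  have h : ketbra x = ketbra x * (ketbra x)ᴴ := by simp [ketbra]
  rw [h]
  exact Matrix.posSemidef_self_mul_conjTranspose _

theorem tens_posSemidef {N a r : ℕ} (h : N = a + r) {X : Op a} {Y : Op r} (hX : X.PosSemidef)
    (hY : Y.PosSemidef) : (tens h X Y).PosSemidef :=
  (hX.kronecker hY).submatrix fun x => (leftBits h x, rightBits h x)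

theorem sliceOp_posSemidef {P p n : ℕ} (h : P = p + n) (q : Bits n) {σ : Op P}
    (hσ : σ.PosSemidef) : (sliceOp h q σ).PosSemidef :=
  hσ.submatrix fun x => joinBits h x q

theorem outcomeProb_ketbra {n : ℕ} (x : Bits n) (ρ : Op n) :
    outcomeProb (ketbra x) ρ = (ρ x x).re := by
  rw [outcomeProb, ketbra, Matrix.trace, Finset.sum_eq_single x]
  · simp
  · intro y _ hy
    simp [Matrix.diag, hy]
  · simp

theorem re_apply_self_nonneg {n : ℕ} {ρ : Op n} (hρ : ρ.PosSemidef) (x : Bits n) :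
    0 ≤ (ρ x x).re :=
  (Complex.nonneg_iff.1 hρ.diag_nonneg).1

theorem tensorOp_ketbra {a b : ℕ} (x : Bits a) (y : Bits b) :
    tensorOp (ketbra x) (ketbra y) = ketbra (joinBits rfl x y) := by
  rw [tensorOp_eq_tens, ketbra, ketbra, tens_single, ketbra]

theorem withKey_apply {κ a b : ℕ} (Φ : SuperOp (κ + a) b) (k : Bits κ) (X : Op a) :
    withKey Φ k X = Φ (tens rfl (ketbra k) X) := by
  rw [← tensorOp_eq_tens]; rfl

/-! ### The circuits of the cloning attack -/

theorem tens_assoc {N P M a b c : ℕ} (h₁ : N = P + c) (h₂ : P = a + b) (h₃ : N = a + M)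
    (h₄ : M = b + c) (X : Op a) (Y : Op b) (Z : Op c) :
    tens h₁ (tens h₂ X Y) Z = tens h₃ X (tens h₄ Y Z) := by
  ext u v
  have e : ∀ u : Bits N, rightBits h₁ u = rightBits h₄ (rightBits h₃ u) := by
    intro u; funext j
    simp only [rightBits]
    congr 1; ext; simp only; omega
  simp only [tens, e, mul_assoc]
  rfl

theorem tens_one_left {r : ℕ} (h : r = 0 + r) (ρ : Op r) : tens h (1 : Op 0) ρ = ρ := by
  ext u v
  have e : ∀ u : Bits r, rightBits h u = u := by
    intro u; funext j
    simp [rightBits]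
  have e' : leftBits h u = leftBits h v := Subsingleton.elim _ _
  rw [tens, e, e, e', Matrix.one_apply_eq, one_mul]

theorem sliceOp_tens_ketbra {P p n : ℕ} (h : P = p + n) (q q' : Bits n) (X : Op p) :
    sliceOp h q' (tens h X (ketbra q)) = if q = q' then X else 0 := by
  ext u v
  simp only [sliceOp, tens_joinBits, ketbra, Matrix.single_apply, and_self]
  split_ifs <;> simp

theorem toMap_copyFront_cast_tens {N M K L n : ℕ} (hN : 0 < N) (hL : N + n = L) (h : N = M + n)
    (h' : L = n + K) (h'' : K = M + n) (Y : Op M) (q : Bits n) :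
    ((copyFront hN n).cast rfl hL).toMap (tens h Y (ketbra q)) =
      tens h' (ketbra q) (tens h'' Y (ketbra q)) := by
  subst hL
  exact toMap_copyFront_tens hN h h' h'' Y q

/-- The splitting circuit of the cloning attack: sample a message `q` with `G`, run `A` on the
ciphertext, and give `q` to both parties. -/
def splitter {ℓ s n β γ : ℕ} (hn : 0 < n) (G : Circuit 0 (s + n)) (A : Circuit (s + ℓ) (β + γ)) :
    Circuit ℓ ((n + β) + (γ + n)) :=
  (((G.embed ℓ).cast (show ℓ + 0 = ℓ by omega) (show ℓ + (s + n) = (s + n) + ℓ by omega)).append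
    (moveBlock (show s < (s + n) + ℓ by omega) n)).append <|
  ((A.embed n).cast (show n + (s + ℓ) = (s + n) + ℓ by omega)
    (show n + (β + γ) = (β + γ) + n by omega)).append <|
  (copyFront (show 0 < (β + γ) + n by omega) n).cast rfl (by omega)

theorem toMap_splitter {ℓ s n β γ : ℕ} (hn : 0 < n) (G : Circuit 0 (s + n))
    (A : Circuit (s + ℓ) (β + γ)) (h : (n + β) + (γ + n) = n + ((β + γ) + n)) (ρ : Op ℓ) :
    (splitter hn G A).toMap ρ = ∑ q : Bits n, tens h (ketbra q)
      (tens rfl (A.toMap (tens rfl (sliceOp rfl q (G.toMap 1)) ρ)) (ketbra q)) := by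
  -- The input becomes a product with the empty register, on which the embedded `G` acts.
  conv_lhs => rw [← tens_one_left (show ℓ = 0 + ℓ by omega) ρ]
  rw [splitter, Circuit.toMap_append, Circuit.toMap_append, Circuit.toMap_append,
    Circuit.toMap_cast_tens _ _ _ rfl,
    toMap_moveBlock_tens (M := s + ℓ) (p := s) (n := n) _ rfl rfl (by omega) rfl, map_sum, map_sum]
  refine Finset.sum_congr rfl fun q _ => ?_
  rw [Circuit.toMap_cast_tens _ _ _ rfl, toMap_copyFront_cast_tens _ _ rfl h rfl]

/-- The first party of the cloning attack: run `B`, and output the conjunction of its result with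
the bits of `q`. -/
def firstGuesser {κ n β : ℕ} (hn : 0 < n) (B : Circuit (κ + β) 1) : Circuit (κ + (n + β)) n :=
  (moveBlock (show κ < κ + (n + β) by omega) n).append <|
  ((B.embed n).cast (show n + (κ + β) = κ + (n + β) by omega) rfl).append (andBlock hn)

/-- The string `q` lies between the key and the register of `B`, so it is moved to the end before
`B` runs. It is already a basis state, so the dephasing yields the single outcome `q`. The second
party receives `q` last and needs no move. -/
theorem toMap_firstGuesser {κ n β : ℕ} (hn : 0 < n) (B : Circuit (κ + β) 1) (k : Bits κ)
    (q : Bits n) (X : Op β) :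
    withKey (firstGuesser hn B).toMap k (tens rfl (ketbra q) X) =
      ∑ b : Bits 1, withKey B.toMap k X b b • ketbra (fun j => b 0 && q j) := by
  rw [withKey_apply, withKey_apply,
    ← tens_assoc (show κ + (n + β) = (κ + n) + β by omega) rfl rfl rfl, firstGuesser,
    Circuit.toMap_append, Circuit.toMap_append,
    toMap_moveBlock_tens (M := κ + β) (p := κ) (n := n) _ _ rfl (by omega) rfl,
    Finset.sum_eq_single q]
  · rw [sliceOp_tens_ketbra, if_pos rfl, Circuit.toMap_cast_tens _ _ _ (by omega),
      toMap_andBlock_tens]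
  · intro q' _ hq
    rw [sliceOp_tens_ketbra, if_neg (Ne.symm hq)]
    ext u v
    simp [tens]
  · simp

/-- The second party of the cloning attack: run `C`, and output the conjunction of its result with
the bits of `q`. -/
def secondGuesser {κ n γ : ℕ} (hn : 0 < n) (C : Circuit (κ + γ) 1) : Circuit (κ + (γ + n)) n :=
  ((C.embed n).cast (show n + (κ + γ) = κ + (γ + n) by omega) rfl).append (andBlock hn)

theorem toMap_secondGuesser {κ n γ : ℕ} (hn : 0 < n) (C : Circuit (κ + γ) 1) (k : Bits κ)
    (q : Bits n) (Y : Op γ) :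
    withKey (secondGuesser hn C).toMap k (tens rfl Y (ketbra q)) =
      ∑ c : Bits 1, withKey C.toMap k Y c c • ketbra (fun j => c 0 && q j) := by
  rw [withKey_apply, withKey_apply,
    ← tens_assoc (show κ + (γ + n) = (κ + γ) + n by omega) rfl rfl rfl, secondGuesser,
    Circuit.toMap_append, Circuit.toMap_cast_tens _ _ _ (by omega), toMap_andBlock_tens]

/-- Regroups the registers as those of the two parties. The state `ω` may be entangled between them,
hence the expansion in matrix units. -/
theorem tens_ketbra_tens_ketbra {n β γ : ℕ} (h : (n + β) + (γ + n) = n + ((β + γ) + n))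
    (K K' : Op n) (ω : Op (β + γ)) :
    tens h K (tens rfl ω K') = ∑ x, ∑ x', ∑ y, ∑ y',
      ω (joinBits rfl x y) (joinBits rfl x' y') •
        tens rfl (tens rfl K (Matrix.single x x' 1)) (tens rfl (Matrix.single y y' 1) K') := by
  have hω : ω = ∑ x, ∑ x', ∑ y, ∑ y', ω (joinBits rfl x y) (joinBits rfl x' y') •
      tens rfl (Matrix.single x x' 1) (Matrix.single y y' 1) := by
    conv_lhs => rw [op_eq_sum ω]
    simp only [sum_bits (rfl : β + γ = β + γ), tens_single]
    refine Finset.sum_congr rfl fun x _ => ?_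
    rw [Finset.sum_comm]
  conv_lhs => rw [hω]
  simp only [tens_sum_left, tens_sum_right, tens_smul_left, tens_smul_right]
  refine Finset.sum_congr rfl fun x _ => Finset.sum_congr rfl fun x' _ =>
    Finset.sum_congr rfl fun y _ => Finset.sum_congr rfl fun y' _ => ?_
  rw [tens_assoc rfl rfl (show β + γ + n = β + (γ + n) by omega) rfl,
    ← tens_assoc rfl rfl h (show β + γ + n = β + (γ + n) by omega)]

theorem sum_comm_block {X Y B : Type*} [Fintype X] [Fintype Y] [Fintype B]
    (F : X → X → Y → Y → B → B → ℂ) :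
    ∑ x, ∑ x', ∑ y, ∑ y', ∑ b, ∑ c, F x x' y y' b c =
      ∑ b, ∑ c, ∑ x, ∑ x', ∑ y, ∑ y', F x x' y y' b c := by
  have hX : ∀ f : X → B → B → ℂ, ∑ x, ∑ b, ∑ c, f x b c = ∑ b, ∑ c, ∑ x, f x b c := by
    intro f
    rw [Finset.sum_comm]
    exact Finset.sum_congr rfl fun b _ => Finset.sum_comm
  have hY : ∀ f : Y → B → B → ℂ, ∑ y, ∑ b, ∑ c, f y b c = ∑ b, ∑ c, ∑ y, f y b c := by
    intro f
    rw [Finset.sum_comm]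
    exact Finset.sum_congr rfl fun b _ => Finset.sum_comm
  simp only [hX, hY]

/-- The parties are known only on products with the classical string `q`; expanding `ω` in matrix
units extends this to entangled states. What remains are the joint outcome weights of the original
parties, restricted to the pairs (b, c) whose two answers are both `m`. -/
theorem tensorMap_guessers_apply {n β γ : ℕ} {Φ : SuperOp β 1} {Ψ : SuperOp γ 1}
    {Φ' : SuperOp (n + β) n} {Ψ' : SuperOp (γ + n) n} {q : Bits n}
    (hΦ : ∀ X, Φ' (tens rfl (ketbra q) X) = ∑ b : Bits 1, Φ X b b • ketbra (fun j => b 0 && q j))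
    (hΨ : ∀ Y, Ψ' (tens rfl Y (ketbra q)) = ∑ c : Bits 1, Ψ Y c c • ketbra (fun j => c 0 && q j))
    (h : (n + β) + (γ + n) = n + ((β + γ) + n)) (ω : Op (β + γ)) (m : Bits n) :
    tensorMap Φ' Ψ' (tens h (ketbra q) (tens rfl ω (ketbra q)))
        (joinBits rfl m m) (joinBits rfl m m) =
      ∑ b : Bits 1, ∑ c : Bits 1,
        if (m = fun j => b 0 && q j) ∧ (m = fun j => c 0 && q j) then
          tensorMap Φ Ψ ω (joinBits rfl b c) (joinBits rfl b c) else 0 := by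
  have hk : ∀ (b : Bits 1), ketbra (fun j => b 0 && q j) m m =
      if (m = fun j => b 0 && q j) then 1 else 0 := by
    intro b
    simp only [ketbra, Matrix.single_apply, and_self, eq_comm]
  have key : ∀ (A : Bits 1 → ℂ) (B : Bits 1 → ℂ),
      (∑ b, A b * if (m = fun j => b 0 && q j) then 1 else 0) *
        (∑ c, B c * if (m = fun j => c 0 && q j) then 1 else 0) =
      ∑ b : Bits 1, ∑ c : Bits 1,
        if (m = fun j => b 0 && q j) ∧ (m = fun j => c 0 && q j) then A b * B c else 0 := by
    intro A B
    rw [Finset.sum_mul_sum]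
    refine Finset.sum_congr rfl fun b _ => Finset.sum_congr rfl fun c _ => ?_
    rw [ite_and]
    split_ifs <;> simp
  rw [tens_ketbra_tens_ketbra]
  simp only [map_sum, map_smul, tensorMap_tens, hΦ, hΨ, Matrix.sum_apply, Matrix.smul_apply,
    smul_eq_mul, tens_joinBits, hk, key, tensorMap_apply Φ Ψ]
  -- As a scalar factor `χ b c`, the winning condition can be moved through the sums and handled by
  -- `ring`.
  obtain ⟨χ, hχ⟩ : ∃ χ : Bits 1 → Bits 1 → ℂ, ∀ b c z,
      (if (m = fun j => b 0 && q j) ∧ (m = fun j => c 0 && q j) then z else 0) = χ b c * z :=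
    ⟨fun b c => if (m = fun j => b 0 && q j) ∧ (m = fun j => c 0 && q j) then 1 else 0,
      fun b c z => by simp only [ite_mul, one_mul, zero_mul]⟩
  simp only [hχ, Finset.mul_sum]
  rw [sum_comm_block]
  refine Finset.sum_congr rfl fun b _ => Finset.sum_congr rfl fun c _ =>
    Finset.sum_congr rfl fun x _ => Finset.sum_congr rfl fun x' _ =>
    Finset.sum_congr rfl fun y _ => Finset.sum_congr rfl fun y' _ => ?_
  ring

/-! ### The circuits of the cloning attack are efficient -/

theorem describeGates_moveBlock {N p : ℕ} (hp : p < N) (t : ℕ) :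
    (moveBlock hp t).describeGates = (List.replicate t
      ([Symbol.aux] ++ describeNat N ++ [Symbol.cnot] ++ describeNat p ++ describeNat N ++
        [Symbol.discard] ++ describeNat p)).flatten := by
  rw [moveBlock, Circuit.describeGates_repeat]
  congr 2
  simp [moveStep, Circuit.describeGates, Gate.describe]

theorem describeGates_copyFront {N : ℕ} (hN : 0 < N) (t : ℕ) :
    (copyFront hN t).describeGates = (List.replicate t
      ([Symbol.aux] ++ describeNat 0 ++ [Symbol.cnot] ++ describeNat N ++
        describeNat 0)).flatten := by
  induction t with
  | zero => rfl
  | succ t ih =>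
    rw [copyFront, Circuit.describeGates_append, ih, List.replicate_succ', List.flatten_concat]
    simp [Circuit.describeGates, Gate.describe]

namespace PolyTime

theorem describeNat {f : ℕ+ → ℕ} (hf : PolyTime fun lam => ticks (f lam))
    (hc : ∀ c, PolyTime fun _ => c) : PolyTime fun lam => describeNat (f lam) :=
  hf.append (hc _)

theorem ticks_add_const {f g : ℕ+ → ℕ} (hf : PolyTime fun lam => ticks (f lam))
    (hc : ∀ c, PolyTime fun _ => c) (n : ℕ) (h : ∀ lam, g lam = f lam + n) :
    PolyTime fun lam => ticks (g lam) := by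
  simpa only [h, ticks_add] using hf.append (hc (ticks n))

theorem ticks_sub_const {f g : ℕ+ → ℕ} (hf : PolyTime fun lam => ticks (f lam)) (n : ℕ)
    (h : ∀ lam, f lam = g lam + n) : PolyTime fun lam => ticks (g lam) := by
  have := hf.drop n
  simpa only [h, ticks, List.drop_replicate, Nat.add_sub_cancel] using this

theorem moveBlock {N p : ℕ+ → ℕ} (hN : PolyTime fun lam => ticks (N lam))
    (hp : PolyTime fun lam => ticks (p lam)) (hc : ∀ c, PolyTime fun _ => c)
    (h : ∀ lam, p lam < N lam) (n : ℕ) {t : ℕ+ → ℕ} (ht : ∀ lam, t lam = n) :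
    PolyTime fun lam => (moveBlock (h lam) (t lam)).describeGates := by
  simp only [describeGates_moveBlock, ht]
  have hN' := hN.describeNat hc
  have hp' := hp.describeNat hc
  exact flatten_replicate ((((((hc [.aux]).append hN').append (hc [.cnot])).append hp').append
    hN').append (hc [.discard]) |>.append hp') (fun lam => by simp) n

theorem copyFront {N : ℕ+ → ℕ} (hN : PolyTime fun lam => ticks (N lam))
    (hc : ∀ c, PolyTime fun _ => c) (h : ∀ lam, 0 < N lam) (n : ℕ) {t : ℕ+ → ℕ}
    (ht : ∀ lam, t lam = n) :
    PolyTime fun lam => (copyFront (h lam) (t lam)).describeGates := by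
  simp only [describeGates_copyFront, ht]
  exact flatten_replicate (((((hc [.aux]).append (hc _)).append (hc [.cnot])).append
    (hN.describeNat hc)).append (hc _)) (fun lam => by simp) n

/-- Its size is a function of `n` alone, so the description is one fixed word. -/
theorem andBlock {t : ℕ+ → ℕ} (hc : ∀ c, PolyTime fun _ => c) (n : ℕ) (h : ∀ lam, 0 < t lam)
    (ht : ∀ lam, t lam = n) : PolyTime fun lam => (andBlock (h lam)).describeGates := by
  obtain rfl : t = fun _ => n := funext ht
  exact hc (UncloneableEncryption.andBlock (h 1)).describeGates

end PolyTime

theorem outcomeProb_splitter {ℓ s n β γ κ : ℕ} (hn : 0 < n) (G : Circuit 0 (s + n))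
    (A : Circuit (s + ℓ) (β + γ)) (B : Circuit (κ + β) 1) (C : Circuit (κ + γ) 1) (k : Bits κ)
    (ρ : Op ℓ) (m : Bits n) :
    outcomeProb (tensorOp (ketbra m) (ketbra m))
      (tensorMap (withKey (firstGuesser hn B).toMap k) (withKey (secondGuesser hn C).toMap k)
        ((splitter hn G A).toMap ρ)) =
      ∑ q, ∑ b : Bits 1, ∑ c : Bits 1,
        if (m = fun j => b 0 && q j) ∧ (m = fun j => c 0 && q j) then
          (tensorMap (withKey B.toMap k) (withKey C.toMap k)
            (A.toMap (tens rfl (sliceOp rfl q (G.toMap 1)) ρ))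
            (joinBits rfl b c) (joinBits rfl b c)).re else 0 := by
  rw [tensorOp_ketbra, outcomeProb_ketbra, toMap_splitter hn G A (by omega), map_sum,
    Matrix.sum_apply, Complex.re_sum]
  refine Finset.sum_congr rfl fun q _ => ?_
  rw [tensorMap_guessers_apply (toMap_firstGuesser hn B k q) (toMap_secondGuesser hn C k q)]
  simp only [Complex.re_sum, apply_ite Complex.re, Complex.zero_re]

/-! ### Efficiency of the cloning attack and comparison of winning probabilities. -/

section Attack

variable {S : QECM} {n : ℕ+} (𝒜 : CloningDistinguishingAttack S)

theorem coe_n_eq (hn : ∀ lam : ℕ+, S.n lam = n) (lam : ℕ+) : (S.n lam : ℕ) = n := by rw [hn]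

theorem polyTimeUniform_splitter (hn : ∀ lam : ℕ+, S.n lam = n) :
    PolyTimeUniform
    (a := fun lam => S.ℓ lam) (b := fun lam => (S.n lam + 𝒜.β lam : ℕ) + (𝒜.γ lam + S.n lam))
    fun lam => splitter (S.n lam).pos (𝒜.G.circuit lam) (𝒜.A.circuit lam) := by
  have hc := 𝒜.G.uniform.polyTime_const
  -- All sizes are read off circuit headers in unary: `s` is the output size of `G` less `n`, and
  -- the others are sizes for `A` plus `n`.
  have hs : PolyTime fun lam => ticks (𝒜.s lam) :=
    𝒜.G.uniform.polyTime_outputs.ticks_sub_const n fun lam => by rw [coe_n_eq hn]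
  have hN : PolyTime fun lam => ticks ((𝒜.s lam + S.n lam : ℕ) + S.ℓ lam) :=
    𝒜.A.uniform.polyTime_inputs.ticks_add_const hc n fun lam => by rw [coe_n_eq hn]; omega
  have hM : PolyTime fun lam => ticks ((𝒜.β lam + 𝒜.γ lam : ℕ) + S.n lam) :=
    𝒜.A.uniform.polyTime_outputs.ticks_add_const hc n fun lam => by rw [coe_n_eq hn]
  refine PolyTimeUniform.of_polyTime (S.Enc.uniform.polyTime_outputs.describeNat hc)
    ((𝒜.A.uniform.polyTime_outputs.ticks_add_const hc (2 * n)
      fun lam => by rw [coe_n_eq hn]; omega).describeNat hc) ?_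
  simp only [splitter, Circuit.describeGates_append, Circuit.describeGates_cast,
    Circuit.describeGates_embed]
  exact (𝒜.G.uniform.polyTime_gates.append (hN.moveBlock hs hc _ n (coe_n_eq hn))).append
    (𝒜.A.uniform.polyTime_gates.append (hM.copyFront hc _ n (coe_n_eq hn)))

theorem polyTimeUniform_firstGuesser (hn : ∀ lam : ℕ+, S.n lam = n) :
    PolyTimeUniform
    (a := fun lam => S.κ lam + (S.n lam + 𝒜.β lam : ℕ)) (b := fun lam => S.n lam)
    fun lam => firstGuesser (S.n lam).pos (𝒜.B.circuit lam) := by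
  have hc := 𝒜.G.uniform.polyTime_const
  have hN : PolyTime fun lam => ticks (S.κ lam + (S.n lam + 𝒜.β lam : ℕ)) :=
    𝒜.B.uniform.polyTime_inputs.ticks_add_const hc n fun lam => by rw [coe_n_eq hn]; omega
  refine PolyTimeUniform.of_polyTime (hN.describeNat hc)
    (by simpa only [coe_n_eq hn] using hc _) ?_
  simp only [firstGuesser, Circuit.describeGates_append, Circuit.describeGates_cast,
    Circuit.describeGates_embed]
  exact (hN.moveBlock S.Key.uniform.polyTime_outputs hc _ n (coe_n_eq hn)).append
    (𝒜.B.uniform.polyTime_gates.append (PolyTime.andBlock hc n _ (coe_n_eq hn)))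

theorem polyTimeUniform_secondGuesser (hn : ∀ lam : ℕ+, S.n lam = n) :
    PolyTimeUniform
    (a := fun lam => S.κ lam + (𝒜.γ lam + S.n lam : ℕ)) (b := fun lam => S.n lam)
    fun lam => secondGuesser (S.n lam).pos (𝒜.C.circuit lam) := by
  have hc := 𝒜.G.uniform.polyTime_const
  have hN : PolyTime fun lam => ticks (S.κ lam + (𝒜.γ lam + S.n lam : ℕ)) :=
    𝒜.C.uniform.polyTime_inputs.ticks_add_const hc n fun lam => by rw [coe_n_eq hn]; omega
  refine PolyTimeUniform.of_polyTime (hN.describeNat hc)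
    (by simpa only [coe_n_eq hn] using hc _) ?_
  simp only [secondGuesser, Circuit.describeGates_append, Circuit.describeGates_cast,
    Circuit.describeGates_embed]
  exact 𝒜.C.uniform.polyTime_gates.append (PolyTime.andBlock hc n _ (coe_n_eq hn))

/-- The cloning attack built from a cloning-distinguishing attack. -/
def CloningDistinguishingAttack.toCloningAttack (hn : ∀ lam : ℕ+, S.n lam = n) :
    CloningAttack S where
  β lam := S.n lam + 𝒜.β lam
  γ lam := 𝒜.γ lam + S.n lam
  A := ⟨_, polyTimeUniform_splitter 𝒜 hn⟩
  B := ⟨_, polyTimeUniform_firstGuesser 𝒜 hn⟩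
  C := ⟨_, polyTimeUniform_secondGuesser 𝒜 hn⟩

namespace CloningDistinguishingAttack

/-- The unnormalized state of the two parties if `G` produces the message `q`, the message `m` is
encrypted with the key `k`, and both parties process their registers. -/
def jointState (lam : ℕ+) (k : Bits (S.κ lam)) (q m : Bits (S.n lam)) : Op (1 + 1) :=
  tensorMap (withKey (𝒜.B.map lam) k) (withKey (𝒜.C.map lam) k) (𝒜.A.map lam
    (tens rfl (sliceOp rfl q (𝒜.G.map lam 1)) (S.encWith lam k (ketbra m))))

/-- The probability of the outcomes `b` and `c`, jointly with the message `q`. -/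
def jointProb (lam : ℕ+) (k : Bits (S.κ lam)) (q m : Bits (S.n lam)) (b c : Bits 1) : ℝ :=
  (𝒜.jointState lam k q m (joinBits rfl b c) (joinBits rfl b c)).re

theorem jointProb_nonneg (lam : ℕ+) (k : Bits (S.κ lam)) (q m : Bits (S.n lam)) (b c : Bits 1) :
    0 ≤ 𝒜.jointProb lam k q m b c := by
  refine re_apply_self_nonneg ?_ _
  refine (((IsKraus.circuit _).withKey k).tensorMap ((IsKraus.circuit _).withKey k)).posSemidef ?_
  refine (IsKraus.circuit _).posSemidef (tens_posSemidef _ (sliceOp_posSemidef _ _ ?_) ?_)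
  · exact (IsKraus.circuit _).posSemidef Matrix.PosSemidef.one
  · exact ((IsKraus.circuit _).withKey k).posSemidef (ketbra_posSemidef m)

end CloningDistinguishingAttack

theorem keyProb_nonneg (S : QECM) (lam : ℕ+) (k : Bits (S.κ lam)) : 0 ≤ S.keyProb lam k := by
  rw [QECM.keyProb, outcomeProb_ketbra]
  exact re_apply_self_nonneg ((IsKraus.circuit _).posSemidef Matrix.PosSemidef.one) _

/-- The string `b && z` is 0^n for bit 0 and `z` for bit 1, so one formula covers both encryption
maps; it is also the rule by which the guessers answer. Off-diagonal units vanish in both cases,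
either under the trace or under the measurement. -/
theorem encBit_single (lam : ℕ+) (k : Bits (S.κ lam)) (b : Bool) (z z' : Bits (S.n lam)) :
    S.encBit lam k b (Matrix.single z z' 1) =
      if z = z' then S.encWith lam k (ketbra fun j => b && z j) else 0 := by
  cases b
  · by_cases h : z = z'
    · subst h
      simp [QECM.encBit]
    · simp [QECM.encBit, h]
  · by_cases h : z = z'
    · subst h
      simp only [QECM.encBit, LinearMap.sum_apply, LinearMap.smulRight_apply,
        LinearMap.comp_apply, LinearMap.mulLeft_apply, Matrix.traceLinearMap_apply]
      rw [Finset.sum_eq_single z]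
      · simp [ketbra]
      · intro m _ hm
        simp [ketbra, hm]
      · simp
    · simp only [QECM.encBit, LinearMap.sum_apply, LinearMap.smulRight_apply,
        LinearMap.comp_apply, LinearMap.mulLeft_apply, Matrix.traceLinearMap_apply, if_neg h]
      refine Finset.sum_eq_zero fun m _ => ?_
      by_cases hm : m = z
      · subst hm
        simp [ketbra, h]
      · simp [ketbra, hm]

/-- For either bit the game may measure the message register first, as the splitter does. Thus both
games are expressed by the same states, indexed by `q`. -/
theorem tensorMap_id_encBit {s : ℕ} (lam : ℕ+) (k : Bits (S.κ lam)) (b : Bool)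
    (σ : Op (s + S.n lam)) :
    tensorMap (LinearMap.id : SuperOp s s) (S.encBit lam k b) σ =
      ∑ q, tens rfl (sliceOp rfl q σ) (S.encWith lam k (ketbra fun j => b && q j)) := by
  have hs : ∀ q, sliceOp rfl q σ = ∑ p, ∑ p', σ (joinBits rfl p q) (joinBits rfl p' q) •
      (Matrix.single p p' 1 : Op s) := fun q => op_eq_sum _
  have hz : ∀ p p' : Bits s, ∑ z, ∑ z', σ (joinBits rfl p z) (joinBits rfl p' z') •
      tens rfl (Matrix.single p p' 1) (S.encBit lam k b (Matrix.single z z' 1)) =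
      ∑ z, σ (joinBits rfl p z) (joinBits rfl p' z) •
        tens rfl (Matrix.single p p' 1) (S.encWith lam k (ketbra fun j => b && z j)) := by
    intro p p'
    refine Finset.sum_congr rfl fun z _ => ?_
    rw [Finset.sum_eq_single z]
    · rw [encBit_single, if_pos rfl]
    · intro z' _ hz
      rw [encBit_single, if_neg (Ne.symm hz)]
      ext u v
      simp [tens]
    · simp
  rw [tensorMap_apply]
  simp only [hs, tens_sum_left, tens_smul_left, LinearMap.id_apply, hz]
  symm
  rw [Finset.sum_comm]
  exact Finset.sum_congr rfl fun p _ => Finset.sum_comm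

namespace CloningDistinguishingAttack

theorem winProb_eq (lam : ℕ+) : 𝒜.winProb lam = (∑ k, S.keyProb lam k * ∑ q,
    (𝒜.jointProb lam k q (fun _ => false) (fun _ => false) (fun _ => false) +
      𝒜.jointProb lam k q q (fun _ => true) (fun _ => true))) / 2 := by
  have h : ∀ (b : Bool) (k : Bits (S.κ lam)), outcomeProb (tensorOp (qubitProj b) (qubitProj b))
      ((tensorMap (withKey (𝒜.B.map lam) k) (withKey (𝒜.C.map lam) k) ∘ₗ 𝒜.A.map lam ∘ₗ
        tensorMap (LinearMap.id : SuperOp (𝒜.s lam) (𝒜.s lam)) (S.encBit lam k b) ∘ₗ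
        𝒜.G.map lam) 1) =
      ∑ q, 𝒜.jointProb lam k q (fun j => b && q j) (fun _ => b) (fun _ => b) := by
    intro b k
    rw [qubitProj, tensorOp_ketbra, outcomeProb_ketbra]
    simp only [LinearMap.comp_apply, tensorMap_id_encBit, map_sum, Matrix.sum_apply,
      Complex.re_sum]
    rfl
  rw [winProb, Fintype.expect_eq_sum_div_card, Fintype.card_bool, Fintype.sum_bool,
    ← Finset.sum_add_distrib]
  simp only [h, ← mul_add, ← Finset.sum_add_distrib, Bool.true_and, Bool.false_and]
  simp only [add_comm]
  norm_num

theorem winProb_toCloningAttack (hn : ∀ lam : ℕ+, S.n lam = n) (lam : ℕ+) :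
    (𝒜.toCloningAttack hn).winProb lam =
    (∑ k, S.keyProb lam k * ∑ q, ∑ m, ∑ b : Bits 1, ∑ c : Bits 1,
      if (m = fun j => b 0 && q j) ∧ (m = fun j => c 0 && q j) then
        𝒜.jointProb lam k q m b c else 0) / 2 ^ (n : ℕ) := by
  have h : ∀ (m : Bits (S.n lam)) (k : Bits (S.κ lam)),
      outcomeProb (tensorOp (ketbra m) (ketbra m))
        ((tensorMap (withKey ((𝒜.toCloningAttack hn).B.map lam) k)
          (withKey ((𝒜.toCloningAttack hn).C.map lam) k) ∘ₗ
            (𝒜.toCloningAttack hn).A.map lam ∘ₗ S.encWith lam k) (ketbra m)) =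
      ∑ q, ∑ b : Bits 1, ∑ c : Bits 1,
        if (m = fun j => b 0 && q j) ∧ (m = fun j => c 0 && q j) then
          𝒜.jointProb lam k q m b c else 0 := by
    intro m k
    exact outcomeProb_splitter (S.n lam).pos (𝒜.G.circuit lam) (𝒜.A.circuit lam)
      (𝒜.B.circuit lam) (𝒜.C.circuit lam) k (S.encWith lam k (ketbra m)) m
  rw [CloningAttack.winProb, Fintype.expect_eq_sum_div_card]
  refine congrArg₂ (· / ·) ((Finset.sum_congr rfl fun m _ => Finset.sum_congr rfl fun k _ =>
    congrArg (S.keyProb lam k * ·) (h m k)).trans ?_) ?_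
  · rw [Finset.sum_comm]
    refine Finset.sum_congr rfl fun k _ => ?_
    rw [← Finset.mul_sum]
    exact congrArg (S.keyProb lam k * ·) Finset.sum_comm
  · rw [Fintype.card_fun, Fintype.card_bool, Fintype.card_fin, coe_n_eq hn]
    norm_cast

/-- The left side consists of two of the nonnegative terms on the right. For q = 0^n and m = 0^n the
mixed outcomes b ≠ c win as well, which is one reason for having only an inequality. -/
theorem jointProb_add_le (lam : ℕ+) (k : Bits (S.κ lam)) (q : Bits (S.n lam)) :
    𝒜.jointProb lam k q (fun _ => false) (fun _ => false) (fun _ => false) +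
        𝒜.jointProb lam k q q (fun _ => true) (fun _ => true) ≤
      ∑ m, ∑ b : Bits 1, ∑ c : Bits 1,
        if (m = fun j => b 0 && q j) ∧ (m = fun j => c 0 && q j) then
          𝒜.jointProb lam k q m b c else 0 := by
  set f : Bits (S.n lam) × Bits 1 × Bits 1 → ℝ := fun t =>
    if (t.1 = fun j => t.2.1 0 && q j) ∧ (t.1 = fun j => t.2.2 0 && q j) then
      𝒜.jointProb lam k q t.1 t.2.1 t.2.2 else 0 with hf
  have hnonneg : ∀ t, 0 ≤ f t := by
    intro t
    simp only [hf]
    split_ifs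
    · exact 𝒜.jointProb_nonneg lam k q _ _ _
    · exact le_rfl
  have hsum : ∑ m, ∑ b : Bits 1, ∑ c : Bits 1, f (m, b, c) = ∑ t, f t := by
    simp only [Fintype.sum_prod_type]
  -- The bits already separate the two triples, even when `q` is the zero string.
  have hne : ((fun _ => false, fun _ => false, fun _ => false) :
      Bits (S.n lam) × Bits 1 × Bits 1) ≠ (q, fun _ => true, fun _ => true) := by
    intro h
    have := congrFun (congrArg (fun t => t.2.1) h) 0
    simp at this
  calc _ = ∑ t ∈ {((fun _ => false, fun _ => false, fun _ => false) :
        Bits (S.n lam) × Bits 1 × Bits 1), (q, fun _ => true, fun _ => true)}, f t := by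
        rw [Finset.sum_pair hne]
        simp [hf]
    _ ≤ ∑ t, f t := Finset.sum_le_sum_of_subset_of_nonneg (Finset.subset_univ _)
        fun t _ _ => hnonneg t
    _ = _ := hsum.symm

theorem le_winProb_toCloningAttack (hn : ∀ lam : ℕ+, S.n lam = n) (lam : ℕ+) :
    (2 : ℝ) ^ (-(((n : ℕ) : ℤ) - 1)) * 𝒜.winProb lam ≤ (𝒜.toCloningAttack hn).winProb lam := by
  have hpow : (2 : ℝ) ^ (-(((n : ℕ) : ℤ) - 1)) = 2 / 2 ^ (n : ℕ) := by
    rw [neg_sub, zpow_sub₀ two_ne_zero, zpow_one, zpow_natCast]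
  rw [winProb_eq, winProb_toCloningAttack, hpow, div_mul_div_comm, mul_comm (2 ^ (n : ℕ) : ℝ),
    mul_div_mul_left _ _ two_ne_zero]
  refine div_le_div_of_nonneg_right ?_ (by positivity)
  exact Finset.sum_le_sum fun k _ => mul_le_mul_of_nonneg_left
    (Finset.sum_le_sum fun q _ => 𝒜.jointProb_add_le lam k q) (keyProb_nonneg S lam k)

end CloningDistinguishingAttack

theorem uncloneableIndistinguishableSecure (hn : ∀ lam : ℕ+, S.n lam = n)
    (h : S.UncloneableSecure fun _ => 0) :
    S.UncloneableIndistinguishableSecure := by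
  intro 𝒜
  obtain ⟨η, hη, hle⟩ := h (𝒜.toCloningAttack hn)
  -- Solving 2^(-(n-1)) * win ≤ 2^(-n) + η for `win` gives 1/2 + 2^(n-1) η, and a constant multiple
  -- of a negligible function is negligible.
  refine ⟨fun lam => 2 ^ ((n : ℕ) - 1) * η lam, hη.const_mul _, fun lam => ?_⟩
  have h₁ := (𝒜.le_winProb_toCloningAttack hn lam).trans (hle lam)
  obtain ⟨d, hd⟩ : ∃ d, (n : ℕ) = d + 1 := ⟨n - 1, by have := n.pos; omega⟩
  have hpos : (0 : ℝ) < 2 ^ d := by positivity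
  simp only [add_zero] at h₁
  rw [coe_n_eq hn, Real.rpow_neg zero_le_two, Real.rpow_natCast, hd,
    show (-(((d + 1 : ℕ) : ℤ) - 1)) = -(d : ℤ) by push_cast; ring, zpow_neg, zpow_natCast,
    inv_mul_le_iff₀ hpos, pow_succ] at h₁
  rw [hd, Nat.add_sub_cancel]
  refine h₁.trans_eq ?_
  field_simp

end Attack

end

end UncloneableEncryption

theorem mainTheorem5 (S : UncloneableEncryption.QECM) (n : ℕ+) (hn : ∀ lam : ℕ+, S.n lam = n) :
    (S.UncloneableSecure (fun _ => 0) → S.UncloneableIndistinguishableSecure) ∧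
    (∀ 𝒜 : UncloneableEncryption.CloningDistinguishingAttack S,
      ∃ 𝒜' : UncloneableEncryption.CloningAttack S, ∀ lam : ℕ+,
        (2 : ℝ) ^ (-(((n : ℕ) : ℤ) - 1)) * 𝒜.winProb lam ≤ 𝒜'.winProb lam) :=
  ⟨UncloneableEncryption.uncloneableIndistinguishableSecure hn,
    fun 𝒜 => ⟨𝒜.toCloningAttack hn, 𝒜.le_winProb_toCloningAttack hn⟩⟩
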